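/- **Setting.** Let $\mathcal X$ be a finite-dimensional Euclidean space, $\mathbb S$ the space of self-adjoint operators on $\mathcal X$ and $\mathbb S_{++}$ the set of positive definite ones. Write $\langle \mathbf A,\mathbf B\rangle=\operatorname{tr}(\mathbf A\mathbf B^*)$, $\|\mathbf A\|_{\rm tr}=\operatorname{tr}\sqrt{\mathbf A\mathbf A^*}$, $\|x\|_{\mathbf H}=\langle x,\mathbf Hx\rangle^{1/2}$, and let $z\langle y,\cdot\rangle$ be the operator $x\mapsto\langle y,x\rangle z$. For $\psi:\mathbb R\to\mathbb R$ (or $\psi$ defined on an interval containing the eigenvalues), $\psi(\mathbf H)=\sum_i\psi(\lambda_i)\mathbf P_i$, where $\mathbf H=\sum_i\lambda_i\mathbf P_i$ is the spectral decomposition. **Assumptions.** 1. $\mathcal H\subset\mathbb S$ is a linear space whose orthogonal projection $\operatorname{proj}_{\mathcal H}$ maps $\mathbb S_{++}$ into $\mathbb S_{++}$, and $\psi(\mathbf H)\in\mathcal H$ for all $\mathbf H\in\mathcal H$ and all $\psi:\mathbb R\to\mathbb R$. 2. $f:\mathcal X\to\mathbb R$ is convex with a minimizer $x^*$, and for some $\nu\in[0,1]$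 and $\mathbf L\in\mathcal H\cap\mathbb S_{++}$, for all $x_1,x_2\in\mathcal X$ and every $\nabla f(x_1)\in\partial f(x_1)$, $$0\le f(x_2)-f(x_1)-\langle\nabla f(x_1),x_2-x_1\rangle\le\tfrac1{1+\nu}\|\mathbf L\|_{\rm tr}^{\frac{1-\nu}2}\|x_2-x_1\|_{\mathbf L}^{1+\nu}.$$ 3. $\nabla f(x;\xi)=\nabla f(x)+n(x;\xi)$ with $\nabla f(x)\in\partial f(x)$ and $\xi\sim\mathcal D$ is a (jointly measurable) stochastic gradient such that, for all $x$, $\mathbb E\,n(x;\xi)=0$ and $\mathbb E\|n(x;\xi)\|^2_{\mathbf\Sigma^{-1}}\le\|\mathbf\Sigma\|_{\rm tr}$, where $\mathbf\Sigma\in\mathcal H\cap\mathbb S_{++}$. 4. $\mathbf L$ and $\mathbf\Sigma$ commute with every element of $\mathcal H$. **Algorithm.** Let $\delta,\mathcal R>0$, $\eta=2\mathcal R$, $\alpha_k=2/(k+2)$, $K\in\{1,2,\dots\}$ and $x_0=\overline x_0\in\mathcal X$. For $k=0,\dots,K$, draw $\xi_k\sim\mathcal D$ independently and set $$g_k=\alpha_k^{-1}\,\nabla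 f\big(\alpha_kx_k+(1-\alpha_k)\overline x_k;\xi_k\big),\qquad \mathbf S_k=\sum_{i=0}^kg_i\langle g_i,\cdot\rangle,$$ $$\mathbf H_k=\operatorname*{arg\,min}_{\mathbf H\in\mathcal H\cap\mathbb S_{++}}\langle\mathbf H,\mathbf S_k\rangle+\langle\mathbf I,\phi(\mathbf H)\rangle,\qquad \phi(h)=\delta h+\eta^2/h,$$ $$x_{k+1}=\operatorname*{arg\,min}_{x\in\mathcal X}\langle g_k,x\rangle+\tfrac12\|x-x_k\|^2_{\mathbf H_k^{-1}},\qquad \overline x_{k+1}=\alpha_kx_{k+1}+(1-\alpha_k)\overline x_k .$$ (So $g_k$ is the stochastic gradient at $x_k$ of $f_k(x)=\alpha_k^{-2}f(\alpha_kx+(1-\alpha_k)\overline x_k)$.) **Theorem.** Suppose that almost surely $\max_{k=0,\dots,K}\big\|\operatorname{proj}_{\mathcal H}\big[(x_k-x^*)\langle x_k-x^*,\cdot\rangle\big]\big\|_{\rm op}^{1/2}\le\mathcal R$. Then $f(\overline x_{K+1})-f(x^*)$ is integrable and $$\mathbb E\big[f(\overline x_{K+1})-f(x^*)\big]\le\frac{\mathcal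 C_K\|\mathbf L\|_{\rm tr}\mathcal R^{1+\nu}}{(K+2)^{\frac{1+3\nu}2}}+\frac{\mathcal C_K\|\mathbf\Sigma\|_{\rm tr}\mathcal R}{\sqrt{K+2}}+\frac{4\sqrt\delta\,\mathcal R\dim\mathcal X}{(K+2)^2}$$ for a constant $\mathcal C_K>0$ with $$\mathcal C_K\le c\Big(1+\ln K+\ln^+\tfrac{\|\mathbf L\|_{\rm tr}\mathcal R^\nu}{\sqrt\delta}+\ln^+\tfrac{\|\mathbf\Sigma\|_{\rm tr}}{\sqrt\delta}\Big),$$ where $\ln^+t=\max\{0,\ln t\}$ and $c>0$ is an absolute constant. Moreover, if all elements of $\mathcal H$ are diagonal in a common orthonormal basis of $\mathcal X$ (as for AdaGrad and DASGO), then every element of $\mathcal H$ commutes with every element of $\mathcal H$, so assumption 4 holds automatically. -/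

import Mathlib

open MeasureTheory ProbabilityTheory
open scoped InnerProductSpace

universe u v w

namespace AccelPrecond

noncomputable section

variable {X : Type u} [NormedAddCommGroup X] [InnerProductSpace ℝ X]

/-! ### Operators on a finite-dimensional Euclidean space -/

/-- The trace of an operator. -/
def tr (T : X →L[ℝ] X) : ℝ := LinearMap.trace ℝ X (T : X →ₗ[ℝ] X)

lemma tr_add (S T : X →L[ℝ] X) : tr (S + T) = tr S + tr T := by
  simp [tr]

lemma tr_smul (c : ℝ) (T : X →L[ℝ] X) : tr (c • T) = c * tr T := by
  simp [tr]

variable [FiniteDimensional ℝ X]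

/-- Self-adjoint positive definite operators. -/
def IsPosDef (T : X →L[ℝ] X) : Prop :=
  IsSelfAdjoint T ∧ ∀ x : X, x ≠ 0 → 0 < ⟪x, T x⟫_ℝ

/-- The inner product `⟨A, B⟩ = tr (A B*)` on operators. -/
def frob : LinearMap.BilinForm ℝ (X →L[ℝ] X) :=
  LinearMap.mk₂ ℝ (fun A B => tr (A * ContinuousLinearMap.adjoint B))
    (fun A A' B => by rw [add_mul, tr_add])
    (fun c A B => by rw [smul_mul_assoc, tr_smul, smul_eq_mul])
    (fun A B B' => by rw [map_add, mul_add, tr_add])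
    (fun c A B => by simp [tr_smul])

lemma frob_apply (A B : X →L[ℝ] X) : frob A B = tr (A * ContinuousLinearMap.adjoint B) := rfl

lemma frob_eq_sum (A B : X →L[ℝ] X) :
    frob A B = ∑ i, ⟪ContinuousLinearMap.adjoint A (stdOrthonormalBasis ℝ X i),
      ContinuousLinearMap.adjoint B (stdOrthonormalBasis ℝ X i)⟫_ℝ := by
  rw [frob_apply, tr, LinearMap.trace_eq_sum_inner _ (stdOrthonormalBasis ℝ X)]
  refine Finset.sum_congr rfl fun i _ => ?_
  simp [ContinuousLinearMap.adjoint_inner_left]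

lemma frob_symm (A B : X →L[ℝ] X) : frob A B = frob B A := by
  simp only [frob_eq_sum, real_inner_comm]

lemma frob_isRefl : (frob : LinearMap.BilinForm ℝ (X →L[ℝ] X)).IsRefl := fun A B h => by
  rw [frob_symm, h]

lemma eq_zero_of_frob_self {A : X →L[ℝ] X} (h : frob A A = 0) : A = 0 := by
  rw [frob_eq_sum, Finset.sum_eq_zero_iff_of_nonneg (fun _ _ => real_inner_self_nonneg)] at h
  have h1 : ContinuousLinearMap.adjoint A = 0 := by
    have : ((ContinuousLinearMap.adjoint A : X →L[ℝ] X) : X →ₗ[ℝ] X) = 0 :=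
      (stdOrthonormalBasis ℝ X).toBasis.ext fun i => by
        simpa using h i (Finset.mem_univ i)
    exact ContinuousLinearMap.coe_injective this
  simpa using congrArg ContinuousLinearMap.adjoint h1

lemma isCompl_frob (𝓗 : Submodule ℝ (X →L[ℝ] X)) : IsCompl 𝓗 (frob.orthogonal 𝓗) := by
  refine LinearMap.BilinForm.isCompl_orthogonal_of_restrict_nondegenerate frob_isRefl ?_
  refine ⟨fun A hA => ?_, fun A hA => ?_⟩ <;>
    exact Subtype.ext (eq_zero_of_frob_self (hA A))

/-- The orthogonal projection of operators onto a linear space `𝓗` of operators, with respect to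
the inner product `frob`. -/
def proj (𝓗 : Submodule ℝ (X →L[ℝ] X)) : (X →L[ℝ] X) →ₗ[ℝ] (X →L[ℝ] X) :=
  Submodule.projection 𝓗 (frob.orthogonal 𝓗) (isCompl_frob 𝓗)

/-- The operator function `ψ(T) = ∑ ψ(μ) P_μ`, summed over the eigenvalues `μ` of `T`, with `P_μ`
the orthogonal projection onto the eigenspace (which is `0` if `μ` is not an eigenvalue). -/
def opFun (ψ : ℝ → ℝ) (T : X →L[ℝ] X) : X →L[ℝ] X :=
  ∑ᶠ μ : ℝ, ψ μ • (Module.End.eigenspace (T : X →ₗ[ℝ] X) μ).starProjection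

/-- The trace norm `tr √(A A*)`. -/
def trNorm (A : X →L[ℝ] X) : ℝ := tr (opFun Real.sqrt (A * ContinuousLinearMap.adjoint A))

/-- The weighted Euclidean norm `‖x‖_H = √⟨x, H x⟩`. -/
def wnorm (H : X →L[ℝ] X) (x : X) : ℝ := Real.sqrt ⟪x, H x⟫_ℝ

/-- The rank-one operator `z ⟨y, ·⟩`. -/
def rankOneOp (z y : X) : X →L[ℝ] X := InnerProductSpace.rankOne ℝ z y

/-- The norm `𝓡(x) = ‖proj_𝓗 (x ⟨x, ·⟩)‖_op ^ (1/2)`. -/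
def distNorm (𝓗 : Submodule ℝ (X →L[ℝ] X)) (x : X) : ℝ :=
  Real.sqrt ‖proj 𝓗 (rankOneOp x x)‖

/-! ### Assumptions -/

/-- The assumptions on the linear space `𝓗` of preconditioners. -/
structure IsPrecondSpace (𝓗 : Submodule ℝ (X →L[ℝ] X)) : Prop where
  selfAdjoint : ∀ T ∈ 𝓗, IsSelfAdjoint T
  proj_posDef : ∀ T : X →L[ℝ] X, IsPosDef T → IsPosDef (proj 𝓗 T)
  opFun_mem : ∀ T ∈ 𝓗, ∀ ψ : ℝ → ℝ, opFun ψ T ∈ 𝓗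

/-- `g` is a subgradient of `f` at `x`. -/
def IsSubgradient (f : X → ℝ) (x g : X) : Prop := ∀ y : X, f x + ⟪g, y - x⟫_ℝ ≤ f y

/-- `f` is convex and `(‖L‖_tr ^ ((1 - ν) / 2), ν)`-Hölder smooth with respect to `‖·‖_L`. -/
structure IsHolderSmooth (𝓗 : Submodule ℝ (X →L[ℝ] X)) (L : X →L[ℝ] X) (ν : ℝ) (f : X → ℝ) :
    Prop where
  mem : L ∈ 𝓗
  posDef : IsPosDef L
  convex : ConvexOn ℝ Set.univ f
  smooth : ∀ x₁ x₂ g : X, IsSubgradient f x₁ g →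
    0 ≤ f x₂ - f x₁ - ⟪g, x₂ - x₁⟫_ℝ ∧
    f x₂ - f x₁ - ⟪g, x₂ - x₁⟫_ℝ
      ≤ 1 / (1 + ν) * trNorm L ^ ((1 - ν) / 2) * wnorm L (x₂ - x₁) ^ (1 + ν)

/-- `G x ζ` is a stochastic estimator of the subgradient `df x ∈ ∂f(x)`: for `ζ ∼ D` the noise
`G x ζ - df x` has zero mean and `E ‖G x ζ - df x‖²_{Σ⁻¹} ≤ ‖Σ‖_tr`. -/
structure IsStochGrad [MeasurableSpace X] {Ξ : Type v} [MeasurableSpace Ξ] (D : Measure Ξ)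
    (𝓗 : Submodule ℝ (X →L[ℝ] X)) (Sig : X →L[ℝ] X) (f : X → ℝ) (df : X → X)
    (G : X → Ξ → X) : Prop where
  mem : Sig ∈ 𝓗
  posDef : IsPosDef Sig
  subgradient : ∀ x, IsSubgradient f x (df x)
  measurable : Measurable (Function.uncurry G)
  integrable : ∀ x, Integrable (fun ζ => G x ζ - df x) D
  mean_zero : ∀ x, ∫ ζ, (G x ζ - df x) ∂D = 0
  sq_integrable : ∀ x, Integrable (fun ζ => wnorm (Ring.inverse Sig) (G x ζ - df x) ^ 2) D
  variance_le : ∀ x, ∫ ζ, wnorm (Ring.inverse Sig) (G x ζ - df x) ^ 2 ∂D ≤ trNorm Sig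

/-- `T` commutes with every element of `𝓗`. -/
def CommutesWith (𝓗 : Submodule ℝ (X →L[ℝ] X)) (T : X →L[ℝ] X) : Prop :=
  ∀ S ∈ 𝓗, T * S = S * T

/-- `𝓗` consists of operators that are diagonal in the basis `b`. -/
def IsDiagonalSpace {ι : Type v} [Fintype ι] (b : OrthonormalBasis ι ℝ X)
    (𝓗 : Submodule ℝ (X →L[ℝ] X)) : Prop :=
  ∀ T ∈ 𝓗, ∀ i, ∃ c : ℝ, T (b i) = c • b i

/-! ### The algorithm -/

/-- The potential `φ(h) = δ h + η² / h`. -/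
def potential (δ η : ℝ) (h : ℝ) : ℝ := δ * h + η ^ 2 / h

/-- The objective `⟨H, S⟩ + ⟨I, φ(H)⟩` that defines the preconditioner. -/
def precondObj (δ η : ℝ) (S H : X →L[ℝ] X) : ℝ :=
  frob H S + frob 1 (opFun (potential δ η) H)

/-- `H` minimises `precondObj δ η S` over the positive definite elements of `𝓗`. -/
def IsPreconditioner (𝓗 : Submodule ℝ (X →L[ℝ] X)) (δ η : ℝ) (S H : X →L[ℝ] X) : Prop :=
  (H ∈ 𝓗 ∧ IsPosDef H) ∧
    ∀ T ∈ 𝓗, IsPosDef T → precondObj δ η S H ≤ precondObj δ η S T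

/-- `y` minimises `⟨g, y⟩ + ½ ‖y - x‖²_{H⁻¹}` over the whole space. -/
def IsPrecondStep (H : X →L[ℝ] X) (g x y : X) : Prop :=
  ∀ z : X, ⟪g, y⟫_ℝ + 1 / 2 * wnorm (Ring.inverse H) (y - x) ^ 2
    ≤ ⟪g, z⟫_ℝ + 1 / 2 * wnorm (Ring.inverse H) (z - x) ^ 2

/-- The momentum parameters `α_k = 2 / (k + 2)`. -/
def momentum (k : ℕ) : ℝ := 2 / ((k : ℝ) + 2)

/-- `x`, `xbar`, `g`, `H` are the quantities computed by the accelerated adaptive preconditioned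
SGD in the iterations `0, …, K` on the samples `s 0, …, s K`, with stochastic gradients `G`.
The gradient `g k` is the stochastic gradient at `x k` of
`f_k(x) = α_k⁻² f(α_k x + (1 - α_k) xbar k)`, so that by the chain rule it is `α_k⁻¹` times
the stochastic gradient of `f` at `α_k x_k + (1 - α_k) xbar k`. -/
structure IsAccelRun {Ξ : Type v} (𝓗 : Submodule ℝ (X →L[ℝ] X)) (G : X → Ξ → X) (δ η : ℝ)
    (α : ℕ → ℝ) (K : ℕ) (x₀ : X) (s : ℕ → Ξ) (x xbar g : ℕ → X) (H : ℕ → X →L[ℝ] X) :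
    Prop where
  init : x 0 = x₀
  init_bar : xbar 0 = x₀
  grad : ∀ k ≤ K, g k = (α k)⁻¹ • G (α k • x k + (1 - α k) • xbar k) (s k)
  precond : ∀ k ≤ K,
    IsPreconditioner 𝓗 δ η (∑ i ∈ Finset.range (k + 1), rankOneOp (g i) (g i)) (H k)
  step : ∀ k ≤ K, IsPrecondStep (H k) (g k) (x k) (x (k + 1))
  average : ∀ k ≤ K, xbar (k + 1) = α k • x (k + 1) + (1 - α k) • xbar k

end

end AccelPrecond

open AccelPrecond

set_option linter.unusedSectionVars false

namespace AccelPrecond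

/-! ### Self-adjoint operators: eigenbases, trace, functional calculus -/

section Operators

variable {X : Type u} [NormedAddCommGroup X] [InnerProductSpace ℝ X] [FiniteDimensional ℝ X]

/-! Put `N k = δ I + proj 𝓗 (∑_{i<k} g_i⟨g_i,·⟩)`, an increasing sequence in `𝓗`. Completing a
square shows that the preconditioner is `H_k = 2R (N (k+1))^(-1/2)`, and the step is `x_{k+1} = x_k
- H_k g_k`.

Convexity at `x*` and at the average, with smoothness between the query point and the new average,
gives a recursion for `α_k⁻² (f(x̄_{k+1}) - f(x*))`, which telescopes because `(1 - α_k) α_k⁻² ≤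
α_{k-1}⁻²` for `k ≥ 1` and `1 - α_0 = 0`. What remains is `∑ ⟨g_k, x_{k+1} - x*⟩`, the noise, and a
Hölder error that Young's inequality splits into `‖x_{k+1} - x_k‖_L²` and a deterministic term.

Let `T = tr √(N (K+1))`. The inner products equal a telescoping difference of distances in the norms
of `√(N (k+1))` minus `R ⟨g_k, N^(-1/2) g_k⟩`. Bounded iterates make the first part at most `R T /
4` (`sum_inner_sqrtOp_sub_le`); the second sums to at least `R T - R √δ dim X` (`tr_sqrtOp_le_sum`).
This leaves the negative budget `-3/4 R T`, which is what pays for the second-order terms.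

Those terms are `∑ ‖N^(-1/2) g_k‖²` weighted by `L` and by `Sig` (the latter from Young's inequality
on the noise against `x_{k+1} - x_k`). Commutation and Klein's inequality bound them by the growth
of `tr (L ln N)` (`sum_weighted_le`). A tangent bound on the logarithm trades this for a logarithmic
constant plus a small multiple of `T`, which the budget absorbs, so no bound on the gradients is
ever needed. The noise against `x_k - x*` has mean zero because `x_k` depends only on earlier
samples. Balancing the Young weights gives the rate. -/

lemma inner_apply_of_isSelfAdjoint {T : X →L[ℝ] X} (hT : IsSelfAdjoint T) (x y : X) :
    ⟪T x, y⟫_ℝ = ⟪x, T y⟫_ℝ :=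
  ContinuousLinearMap.isSelfAdjoint_iff_isSymmetric.1 hT x y

lemma isSelfAdjoint_of_inner {T : X →L[ℝ] X} (hT : ∀ x y, ⟪T x, y⟫_ℝ = ⟪x, T y⟫_ℝ) :
    IsSelfAdjoint T :=
  ContinuousLinearMap.isSelfAdjoint_iff_isSymmetric.2 hT

lemma ext_orthonormalBasis {ι : Type*} [Fintype ι] (b : OrthonormalBasis ι ℝ X)
    {S T : X →L[ℝ] X} (h : ∀ i, S (b i) = T (b i)) : S = T :=
  ContinuousLinearMap.coe_injective (b.toBasis.ext fun i => by simpa using h i)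

lemma exists_eigenbasis {T : X →L[ℝ] X} (hT : IsSelfAdjoint T) :
    ∃ (b : OrthonormalBasis (Fin (Module.finrank ℝ X)) ℝ X) (a : Fin (Module.finrank ℝ X) → ℝ),
      ∀ i, T (b i) = a i • b i := by
  have h := ContinuousLinearMap.isSelfAdjoint_iff_isSymmetric.1 hT
  exact ⟨h.eigenvectorBasis rfl, h.eigenvalues rfl, fun i => h.apply_eigenvectorBasis rfl i⟩

lemma isSelfAdjoint_of_diagonal {ι : Type*} [Fintype ι] (b : OrthonormalBasis ι ℝ X)
    {T : X →L[ℝ] X} {a : ι → ℝ} (h : ∀ i, T (b i) = a i • b i) : IsSelfAdjoint T := by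
  classical
  rw [ContinuousLinearMap.isSelfAdjoint_iff']
  refine ext_orthonormalBasis b fun i => InnerProductSpace.ext_inner_right_basis b.toBasis fun j => ?_
  rw [b.coe_toBasis, ContinuousLinearMap.adjoint_inner_left, h, h, inner_smul_left,
    inner_smul_right, b.inner_eq_ite]
  split_ifs with hij
  · simp [hij]
  · simp

lemma inner_apply_diagonal {ι : Type*} [Fintype ι] (b : OrthonormalBasis ι ℝ X)
    {T : X →L[ℝ] X} {a : ι → ℝ} (h : ∀ i, T (b i) = a i • b i) (x : X) :
    ⟪x, T x⟫_ℝ = ∑ i, a i * ⟪b i, x⟫_ℝ ^ 2 := by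
  have hT := isSelfAdjoint_of_diagonal b h
  rw [← b.sum_inner_mul_inner x (T x)]
  refine Finset.sum_congr rfl fun i _ => ?_
  rw [← inner_apply_of_isSelfAdjoint hT, h, real_inner_smul_left, real_inner_comm x]
  ring

lemma sum_sq_inner_left {ι : Type*} [Fintype ι] (b : OrthonormalBasis ι ℝ X) (x : X) :
    ∑ i, ⟪b i, x⟫_ℝ ^ 2 = ‖x‖ ^ 2 := by
  rw [← real_inner_self_eq_norm_sq, ← b.sum_inner_mul_inner x x]
  refine Finset.sum_congr rfl fun i _ => ?_
  rw [real_inner_comm x]; ring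

/-! ### The trace -/

lemma tr_eq_sum {ι : Type*} [Fintype ι] (b : OrthonormalBasis ι ℝ X) (T : X →L[ℝ] X) :
    tr T = ∑ i, ⟪b i, T (b i)⟫_ℝ := by
  rw [tr, LinearMap.trace_eq_sum_inner _ b]
  rfl

lemma tr_mul_comm (S T : X →L[ℝ] X) : tr (S * T) = tr (T * S) :=
  LinearMap.trace_mul_comm ℝ (S : X →ₗ[ℝ] X) (T : X →ₗ[ℝ] X)

lemma tr_sub (S T : X →L[ℝ] X) : tr (S - T) = tr S - tr T := by
  simp [tr]

lemma tr_one : tr (1 : X →L[ℝ] X) = Module.finrank ℝ X := by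
  simp [tr, ContinuousLinearMap.toLinearMap_one]

lemma tr_mul_diagonal {ι : Type*} [Fintype ι] (b : OrthonormalBasis ι ℝ X) (L : X →L[ℝ] X)
    {T : X →L[ℝ] X} {a : ι → ℝ} (h : ∀ i, T (b i) = a i • b i) :
    tr (L * T) = ∑ i, a i * ⟪b i, L (b i)⟫_ℝ := by
  rw [tr_eq_sum b]
  exact Finset.sum_congr rfl fun i _ => by simp [h, inner_smul_right]

lemma rankOneOp_apply (z y x : X) : rankOneOp z y x = ⟪y, x⟫_ℝ • z := rfl

lemma isSelfAdjoint_rankOneOp (z : X) : IsSelfAdjoint (rankOneOp z z) := by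
  refine isSelfAdjoint_of_inner fun x y => ?_
  simp only [rankOneOp_apply, real_inner_smul_left, real_inner_smul_right]
  rw [real_inner_comm x z]; ring

lemma inner_rankOneOp (z x : X) : ⟪x, rankOneOp z z x⟫_ℝ = ⟪z, x⟫_ℝ ^ 2 := by
  rw [rankOneOp_apply, real_inner_smul_right, real_inner_comm z x]; ring

lemma tr_mul_rankOneOp (T : X →L[ℝ] X) (z : X) : tr (T * rankOneOp z z) = ⟪z, T z⟫_ℝ := by
  let b := stdOrthonormalBasis ℝ X
  rw [tr_eq_sum b, ← b.sum_inner_mul_inner z (T z)]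
  refine Finset.sum_congr rfl fun i _ => ?_
  simp [rankOneOp_apply, inner_smul_right]

lemma tr_nonneg {T : X →L[ℝ] X} (h : ∀ x, 0 ≤ ⟪x, T x⟫_ℝ) : 0 ≤ tr T := by
  rw [tr_eq_sum (stdOrthonormalBasis ℝ X)]
  exact Finset.sum_nonneg fun i _ => h _

lemma tr_mono {S T : X →L[ℝ] X} (h : ∀ x, ⟪x, S x⟫_ℝ ≤ ⟪x, T x⟫_ℝ) : tr S ≤ tr T := by
  rw [tr_eq_sum (stdOrthonormalBasis ℝ X), tr_eq_sum (stdOrthonormalBasis ℝ X)]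
  exact Finset.sum_le_sum fun i _ => h _

lemma IsPosDef.nonneg {T : X →L[ℝ] X} (h : IsPosDef T) (x : X) : 0 ≤ ⟪x, T x⟫_ℝ := by
  rcases eq_or_ne x 0 with rfl | hx
  · simp
  · exact (h.2 x hx).le

lemma eigenvalue_eq_inner {ι : Type*} [Fintype ι] (b : OrthonormalBasis ι ℝ X)
    {T : X →L[ℝ] X} {a : ι → ℝ} (h : ∀ i, T (b i) = a i • b i) (i : ι) :
    a i = ⟪b i, T (b i)⟫_ℝ := by
  rw [h, real_inner_smul_right, real_inner_self_eq_norm_sq, b.norm_eq_one]; simp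

lemma orthonormalBasis_ne_zero {ι : Type*} [Fintype ι] (b : OrthonormalBasis ι ℝ X) (i : ι) :
    b i ≠ 0 := fun h => by simpa [h] using b.norm_eq_one i

lemma IsPosDef.eigenvalue_pos {ι : Type*} [Fintype ι] {b : OrthonormalBasis ι ℝ X}
    {T : X →L[ℝ] X} (hT : IsPosDef T) {a : ι → ℝ} (h : ∀ i, T (b i) = a i • b i) (i : ι) :
    0 < a i := by
  rw [eigenvalue_eq_inner b h]
  exact hT.2 _ (orthonormalBasis_ne_zero b i)

lemma isPosDef_of_diagonal {ι : Type*} [Fintype ι] (b : OrthonormalBasis ι ℝ X)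
    {T : X →L[ℝ] X} {a : ι → ℝ} (h : ∀ i, T (b i) = a i • b i) (ha : ∀ i, 0 < a i) :
    IsPosDef T := by
  refine ⟨isSelfAdjoint_of_diagonal b h, fun x hx => ?_⟩
  rw [inner_apply_diagonal b h]
  have h0 : 0 < ∑ i, ⟪b i, x⟫_ℝ ^ 2 := by
    rw [sum_sq_inner_left]; positivity
  obtain ⟨i, _, hi⟩ := Finset.exists_lt_of_sum_lt (s := Finset.univ) (f := fun _ => (0 : ℝ))
    (g := fun i => ⟪b i, x⟫_ℝ ^ 2) (by simpa using h0)
  exact Finset.sum_pos' (fun j _ => mul_nonneg (ha j).le (sq_nonneg _))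
    ⟨i, Finset.mem_univ i, mul_pos (ha i) hi⟩

lemma isPosDef_one : IsPosDef (1 : X →L[ℝ] X) :=
  ⟨IsSelfAdjoint.one _, fun x hx => by simpa using pow_pos (norm_pos_iff.2 hx) 2⟩

/-- `tr (D P) ≤ ‖P‖ tr D` for positive semidefinite `D`. -/
lemma tr_mul_le_norm_mul_tr {D : X →L[ℝ] X} (hD : IsSelfAdjoint D) (h0 : ∀ x, 0 ≤ ⟪x, D x⟫_ℝ)
    (P : X →L[ℝ] X) : tr (D * P) ≤ ‖P‖ * tr D := by
  obtain ⟨b, a, h⟩ := exists_eigenbasis hD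
  rw [tr_mul_comm, tr_mul_diagonal b P h, ← one_mul D, tr_mul_diagonal b 1 h, Finset.mul_sum]
  refine Finset.sum_le_sum fun i _ => ?_
  have ha : 0 ≤ a i := by rw [eigenvalue_eq_inner b h]; exact h0 _
  have h1 : ⟪b i, P (b i)⟫_ℝ ≤ ‖P‖ := by
    refine (real_inner_le_norm _ _).trans ?_
    have := P.le_opNorm (b i)
    rw [b.norm_eq_one] at this ⊢
    linarith
  simpa [mul_comm] using mul_le_mul_of_nonneg_left h1 ha

/-- `tr (D P) ≤ tr D tr P` for positive semidefinite `D` and `P`. -/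
lemma tr_mul_le_tr_mul_tr {D P : X →L[ℝ] X} (hD : IsSelfAdjoint D) (h0 : ∀ x, 0 ≤ ⟪x, D x⟫_ℝ)
    (hP : ∀ x, 0 ≤ ⟪x, P x⟫_ℝ) : tr (D * P) ≤ tr D * tr P := by
  obtain ⟨b, a, h⟩ := exists_eigenbasis hD
  rw [tr_mul_comm, tr_mul_diagonal b P h, ← one_mul D, tr_mul_diagonal b 1 h, Finset.sum_mul]
  refine Finset.sum_le_sum fun i _ => ?_
  have ha : 0 ≤ a i := by rw [eigenvalue_eq_inner b h]; exact h0 _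
  have h1 : ⟪b i, P (b i)⟫_ℝ ≤ tr P := by
    rw [tr_eq_sum b]
    exact Finset.single_le_sum (f := fun i => ⟪b i, P (b i)⟫_ℝ) (fun j _ => hP _)
      (Finset.mem_univ i)
  simpa using mul_le_mul_of_nonneg_left h1 ha

/-! ### Operator functions -/

/-- Distinct eigenspaces are orthogonal, so only the projector for `a` survives on `x`. Through this
lemma, identities for `opFun` reduce to scalar ones on an eigenbasis. -/
lemma opFun_apply_eigenvector (ψ : ℝ → ℝ) {T : X →L[ℝ] X} (hT : IsSelfAdjoint T) {a : ℝ} {x : X}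
    (hx : T x = a • x) : opFun ψ T x = ψ a • x := by
  have hs : (T : X →ₗ[ℝ] X).IsSymmetric := ContinuousLinearMap.isSelfAdjoint_iff_isSymmetric.1 hT
  have hfin : (Function.support fun μ : ℝ =>
      ψ μ • (Module.End.eigenspace (T : X →ₗ[ℝ] X) μ).starProjection).Finite := by
    refine (Module.End.finite_hasEigenvalue (T : X →ₗ[ℝ] X)).subset fun μ hμ => ?_
    intro h0
    apply hμ
    have h0' : Module.End.eigenspace (T : X →ₗ[ℝ] X) μ = ⊥ := by
      simpa [Module.End.eigenspace] using h0
    simp [h0']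
  have hmem : x ∈ Module.End.eigenspace (T : X →ₗ[ℝ] X) a :=
    Module.End.mem_eigenspace_iff.2 hx
  -- `a` is inserted by hand: it can lie outside the support, for instance when `ψ a = 0`.
  rw [opFun, finsum_eq_sum_of_support_subset (s := insert a hfin.toFinset) _
    (by intro μ hμ; simpa using Or.inr hμ), _root_.sum_apply,
    Finset.sum_eq_single a]
  · simp only [_root_.smul_apply]
    rw [Submodule.starProjection_eq_self_iff.2 hmem]
  · intro μ _ hμ
    simp only [_root_.smul_apply]
    rw [(Submodule.starProjection_apply_eq_zero_iff _).2, smul_zero]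
    rw [Submodule.mem_orthogonal]
    intro y hy
    have := hs.orthogonalFamily_eigenspaces hμ ⟨y, hy⟩ ⟨x, hmem⟩
    simpa using this
  · intro h; simp at h

lemma isSelfAdjoint_opFun (ψ : ℝ → ℝ) {T : X →L[ℝ] X} (hT : IsSelfAdjoint T) :
    IsSelfAdjoint (opFun ψ T) := by
  obtain ⟨b, a, h⟩ := exists_eigenbasis hT
  exact isSelfAdjoint_of_diagonal b fun i => opFun_apply_eigenvector ψ hT (h i)

lemma isPosDef_opFun {ψ : ℝ → ℝ} {T : X →L[ℝ] X} (hT : IsPosDef T)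
    (hψ : ∀ t, 0 < t → 0 < ψ t) : IsPosDef (opFun ψ T) := by
  obtain ⟨b, a, h⟩ := exists_eigenbasis hT.1
  exact isPosDef_of_diagonal b (fun i => opFun_apply_eigenvector ψ hT.1 (h i))
    fun i => hψ _ (hT.eigenvalue_pos h i)

lemma opFun_mul_opFun {ψ χ ρ : ℝ → ℝ} {T : X →L[ℝ] X} (hT : IsPosDef T)
    (h0 : ∀ t, 0 < t → ψ t * χ t = ρ t) : opFun ψ T * opFun χ T = opFun ρ T := by
  obtain ⟨b, a, h⟩ := exists_eigenbasis hT.1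
  refine ext_orthonormalBasis b fun i => ?_
  rw [mul_apply_eq_comp, opFun_apply_eigenvector χ hT.1 (h i), map_smul,
    opFun_apply_eigenvector ψ hT.1 (h i), opFun_apply_eigenvector ρ hT.1 (h i), smul_smul,
    ← h0 _ (hT.eigenvalue_pos h i), mul_comm]

lemma opFun_id {T : X →L[ℝ] X} (hT : IsSelfAdjoint T) : opFun (fun t => t) T = T := by
  obtain ⟨b, a, h⟩ := exists_eigenbasis hT
  refine ext_orthonormalBasis b fun i => ?_
  rw [opFun_apply_eigenvector _ hT (h i), h]

lemma opFun_const_one {T : X →L[ℝ] X} (hT : IsSelfAdjoint T) : opFun (fun _ => 1) T = 1 := by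
  obtain ⟨b, a, h⟩ := exists_eigenbasis hT
  refine ext_orthonormalBasis b fun i => ?_
  rw [opFun_apply_eigenvector _ hT (h i)]; simp

lemma opFun_sq {T : X →L[ℝ] X} (hT : IsSelfAdjoint T) : opFun (fun t => t ^ 2) T = T * T := by
  obtain ⟨b, a, h⟩ := exists_eigenbasis hT
  refine ext_orthonormalBasis b fun i => ?_
  rw [opFun_apply_eigenvector _ hT (h i), mul_apply_eq_comp, h, map_smul, h,
    smul_smul, sq]

lemma commute_opFun {S T : X →L[ℝ] X} (hT : IsSelfAdjoint T) (h : S * T = T * S) (ψ : ℝ → ℝ) :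
    S * opFun ψ T = opFun ψ T * S := by
  obtain ⟨b, a, hb⟩ := exists_eigenbasis hT
  refine ext_orthonormalBasis b fun i => ?_
  have h1 : T (S (b i)) = a i • S (b i) := by
    rw [← mul_apply_eq_comp, ← h, mul_apply_eq_comp, hb, map_smul]
  rw [mul_apply_eq_comp, mul_apply_eq_comp,
    opFun_apply_eigenvector ψ hT (hb i), opFun_apply_eigenvector ψ hT h1, map_smul]

lemma trNorm_eq_tr {T : X →L[ℝ] X} (hT : IsPosDef T) : trNorm T = tr T := by
  rw [trNorm]
  congr 1
  obtain ⟨b, a, h⟩ := exists_eigenbasis hT.1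
  have h2 : ∀ i, (T * ContinuousLinearMap.adjoint T) (b i) = (a i ^ 2) • b i := fun i => by
    rw [ContinuousLinearMap.isSelfAdjoint_iff'.1 hT.1, mul_apply_eq_comp, h, map_smul,
      h, smul_smul, sq]
  refine ext_orthonormalBasis b fun i => ?_
  rw [opFun_apply_eigenvector _ (isSelfAdjoint_of_diagonal b h2) (h2 i), h,
    Real.sqrt_sq (hT.eigenvalue_pos h i).le]

lemma IsPosDef.isUnit {T : X →L[ℝ] X} (hT : IsPosDef T) : IsUnit T := by
  have h1 : opFun (fun t => t) T * opFun (fun t => t⁻¹) T = 1 := by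
    rw [opFun_mul_opFun hT (ρ := fun _ => 1) fun t ht => mul_inv_cancel₀ ht.ne',
      opFun_const_one hT.1]
  have h2 : opFun (fun t => t⁻¹) T * opFun (fun t => t) T = 1 := by
    rw [opFun_mul_opFun hT (ρ := fun _ => 1) fun t ht => inv_mul_cancel₀ ht.ne',
      opFun_const_one hT.1]
  rw [opFun_id hT.1] at h1 h2
  exact ⟨⟨T, _, h1, h2⟩, rfl⟩

lemma inverse_eq_opFun {T : X →L[ℝ] X} (hT : IsPosDef T) :
    Ring.inverse T = opFun (fun t => t⁻¹) T := by
  have h1 : opFun (fun t => t) T * opFun (fun t => t⁻¹) T = 1 := by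
    rw [opFun_mul_opFun hT (ρ := fun _ => 1) fun t ht => mul_inv_cancel₀ ht.ne',
      opFun_const_one hT.1]
  rw [opFun_id hT.1] at h1
  calc Ring.inverse T = Ring.inverse T * (T * opFun (fun t => t⁻¹) T) := by rw [h1, mul_one]
    _ = _ := by rw [← mul_assoc, Ring.inverse_mul_cancel _ hT.isUnit, one_mul]

lemma isPosDef_inverse {T : X →L[ℝ] X} (hT : IsPosDef T) : IsPosDef (Ring.inverse T) := by
  rw [inverse_eq_opFun hT]
  exact isPosDef_opFun hT fun t ht => inv_pos.2 ht

lemma wnorm_sq {T : X →L[ℝ] X} (hT : IsPosDef T) (x : X) : wnorm T x ^ 2 = ⟪x, T x⟫_ℝ :=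
  Real.sq_sqrt (hT.nonneg x)

lemma isPosDef_smul {T : X →L[ℝ] X} (hT : IsPosDef T) {c : ℝ} (hc : 0 < c) :
    IsPosDef (c • T) := by
  refine ⟨isSelfAdjoint_of_inner fun x y => ?_, fun x hx => ?_⟩
  · simp [real_inner_smul_left, real_inner_smul_right, inner_apply_of_isSelfAdjoint hT.1]
  · simpa [real_inner_smul_right] using mul_pos hc (hT.2 x hx)

end Operators

/-! ### Operator square roots and trace inequalities -/

noncomputable section SquareRoots

variable {X : Type u} [NormedAddCommGroup X] [InnerProductSpace ℝ X] [FiniteDimensional ℝ X]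

/-- The square root `T ^ (1/2)`. -/
def sqrtOp (T : X →L[ℝ] X) : X →L[ℝ] X := opFun Real.sqrt T

/-- The inverse square root `T ^ (-1/2)`. -/
def invSqrtOp (T : X →L[ℝ] X) : X →L[ℝ] X := opFun (fun t => (Real.sqrt t)⁻¹) T

lemma isPosDef_sqrtOp {T : X →L[ℝ] X} (hT : IsPosDef T) : IsPosDef (sqrtOp T) :=
  isPosDef_opFun hT fun _ ht => Real.sqrt_pos.2 ht

lemma isPosDef_invSqrtOp {T : X →L[ℝ] X} (hT : IsPosDef T) : IsPosDef (invSqrtOp T) :=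
  isPosDef_opFun hT fun _ ht => inv_pos.2 (Real.sqrt_pos.2 ht)

lemma sqrtOp_mul_self {T : X →L[ℝ] X} (hT : IsPosDef T) : sqrtOp T * sqrtOp T = T := by
  rw [sqrtOp, opFun_mul_opFun hT (ρ := fun t => t) fun t ht => Real.mul_self_sqrt ht.le,
    opFun_id hT.1]

lemma sqrtOp_mul_invSqrtOp {T : X →L[ℝ] X} (hT : IsPosDef T) : sqrtOp T * invSqrtOp T = 1 := by
  rw [sqrtOp, invSqrtOp, opFun_mul_opFun hT (ρ := fun _ => 1)
    fun t ht => mul_inv_cancel₀ (Real.sqrt_pos.2 ht).ne', opFun_const_one hT.1]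

lemma invSqrtOp_mul_sqrtOp {T : X →L[ℝ] X} (hT : IsPosDef T) : invSqrtOp T * sqrtOp T = 1 := by
  rw [sqrtOp, invSqrtOp, opFun_mul_opFun hT (ρ := fun _ => 1)
    fun t ht => inv_mul_cancel₀ (Real.sqrt_pos.2 ht).ne', opFun_const_one hT.1]

lemma invSqrtOp_mul_self {T : X →L[ℝ] X} (hT : IsPosDef T) :
    invSqrtOp T * invSqrtOp T = opFun (fun t => t⁻¹) T := by
  rw [invSqrtOp, opFun_mul_opFun hT]
  intro t ht
  rw [← mul_inv, Real.mul_self_sqrt ht.le]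

lemma opFun_inv_mul {T : X →L[ℝ] X} (hT : IsPosDef T) : opFun (fun t => t⁻¹) T * T = 1 := by
  rw [← inverse_eq_opFun hT, Ring.inverse_mul_cancel _ hT.isUnit]

lemma inner_mul_self {T : X →L[ℝ] X} (hT : IsSelfAdjoint T) (x : X) :
    ⟪x, (T * T) x⟫_ℝ = ‖T x‖ ^ 2 := by
  rw [mul_apply_eq_comp, ← inner_apply_of_isSelfAdjoint hT, real_inner_self_eq_norm_sq]

/-- The square root is operator monotone. -/
lemma inner_sqrtOp_mono {A B : X →L[ℝ] X} (hA : IsPosDef A) (hB : IsPosDef B)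
    (h : ∀ x, ⟪x, B x⟫_ℝ ≤ ⟪x, A x⟫_ℝ) (x : X) : ⟪x, sqrtOp B x⟫_ℝ ≤ ⟪x, sqrtOp A x⟫_ℝ := by
  have hA' := isPosDef_sqrtOp hA
  have hB' := isPosDef_sqrtOp hB
  obtain ⟨b, a, hb⟩ := exists_eigenbasis (hA'.1.sub hB'.1)
  have key : ∀ i, 0 ≤ a i := fun i => by
    -- On a unit eigenvector `u` of `√A - √B` with eigenvalue `a < 0`, `√B u = √A u + |a| u`, hence
    -- `‖√B u‖ > ‖√A u‖`, against `B ≤ A`.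
    by_contra hneg
    have h1 : sqrtOp B (b i) = sqrtOp A (b i) + (-a i) • b i := by
      have := hb i
      rw [_root_.sub_apply] at this
      rw [neg_smul, ← this]; abel
    have h2 := h (b i)
    rw [← sqrtOp_mul_self hA, ← sqrtOp_mul_self hB, inner_mul_self hA'.1, inner_mul_self hB'.1,
      h1, norm_add_sq_real, real_inner_smul_right, real_inner_comm, norm_smul, b.norm_eq_one] at h2
    have h3 := hA'.nonneg (b i)
    have h4 : 0 < ‖-a i‖ := by simpa using fun h => hneg h.ge
    nlinarith [mul_nonneg (neg_nonneg.2 (not_le.1 hneg).le) h3]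
  have h5 : 0 ≤ ⟪x, (sqrtOp A - sqrtOp B) x⟫_ℝ := by
    rw [inner_apply_diagonal b hb]
    exact Finset.sum_nonneg fun i _ => mul_nonneg (key i) (sq_nonneg _)
  rw [_root_.sub_apply, inner_sub_right] at h5
  linarith

/-- `tr (A⁻¹ B²) ≤ tr B` for positive semidefinite `B ≤ A`. -/
lemma tr_mul_mul_self_le {A B W : X →L[ℝ] X} (hAW : A * W = 1) (hB : IsSelfAdjoint B)
    (hB0 : ∀ x, 0 ≤ ⟪x, B x⟫_ℝ) (h : ∀ x, ⟪x, B x⟫_ℝ ≤ ⟪x, A x⟫_ℝ) :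
    tr (W * (B * B)) ≤ tr B := by
  rw [← mul_assoc, tr_mul_comm]
  refine tr_mono fun x => ?_
  rw [mul_apply_eq_comp, mul_apply_eq_comp]
  set y := W (B x) with hy
  have hAy : A y = B x := by
    rw [hy, ← mul_apply_eq_comp A W, hAW]; rfl
  -- With `y = A⁻¹ B x`, expanding `⟨x - y, B (x - y)⟩ ≥ 0` and using `⟨y, B y⟩ ≤ ⟨y, A y⟩ = ⟨y, B
  -- x⟩` gives `B A⁻¹ B ≤ B` as quadratic forms.
  have h1 := hB0 (x - y)
  have h2 := h y
  have h3 : ⟪y, B x⟫_ℝ = ⟪x, B y⟫_ℝ := by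
    rw [← inner_apply_of_isSelfAdjoint hB, real_inner_comm]
  rw [hAy] at h2
  simp only [map_sub, inner_sub_left, inner_sub_right] at h1
  linarith

/-- Klein's inequality for the weighted logarithm: `B ↦ tr (L ln B)` is concave on the positive
definite operators commuting with `L`. -/
lemma tr_mul_inv_mul_sub_le {A B L : X →L[ℝ] X} (hA : IsPosDef A) (hB : IsPosDef B)
    (hL : IsPosDef L) (hBL : B * L = L * B) :
    tr (L * opFun (fun t => t⁻¹) A * (A - B))
      ≤ tr (L * opFun Real.log A) - tr (L * opFun Real.log B) := by
  obtain ⟨u, a, hu⟩ := exists_eigenbasis hA.1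
  obtain ⟨v, β, hv⟩ := exists_eigenbasis hB.1
  set C := sqrtOp L with hC
  have hC1 : IsSelfAdjoint C := (isPosDef_sqrtOp hL).1
  have hCC : C * C = L := sqrtOp_mul_self hL
  have hBC : B * C = C * B := commute_opFun hL.1 hBL _
  have hLx : ∀ x, ⟪x, L x⟫_ℝ = ‖C x‖ ^ 2 := fun x => by rw [← hCC, inner_mul_self hC1]
  -- All four traces are written with the same nonnegative weights `⟨v_j, √L u_i⟩²` over a pair of
  -- eigenbases, so the claim reduces to `1 - β/a ≤ ln a - ln β` for each pair.
  have e1 : tr (L * opFun Real.log A) = ∑ i, ∑ j, Real.log (a i) * ⟪v j, C (u i)⟫_ℝ ^ 2 := by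
    rw [tr_mul_diagonal u L fun i => opFun_apply_eigenvector _ hA.1 (hu i)]
    refine Finset.sum_congr rfl fun i _ => ?_
    rw [hLx, ← sum_sq_inner_left v, Finset.mul_sum]
  have e2 : tr (L * opFun Real.log B) = ∑ i, ∑ j, Real.log (β j) * ⟪v j, C (u i)⟫_ℝ ^ 2 := by
    rw [tr_mul_diagonal v L fun i => opFun_apply_eigenvector _ hB.1 (hv i), Finset.sum_comm]
    refine Finset.sum_congr rfl fun j _ => ?_
    rw [hLx, ← sum_sq_inner_left u, Finset.mul_sum]
    refine Finset.sum_congr rfl fun i _ => ?_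
    rw [← inner_apply_of_isSelfAdjoint hC1, real_inner_comm]
  have e3 : tr (L * opFun (fun t => t⁻¹) A * A) = ∑ i, ∑ j, ⟪v j, C (u i)⟫_ℝ ^ 2 := by
    rw [mul_assoc, opFun_inv_mul hA, mul_one, tr_eq_sum u]
    refine Finset.sum_congr rfl fun i _ => ?_
    rw [hLx, ← sum_sq_inner_left v]
  have e4 : tr (L * opFun (fun t => t⁻¹) A * B)
      = ∑ i, ∑ j, (a i)⁻¹ * β j * ⟪v j, C (u i)⟫_ℝ ^ 2 := by
    rw [tr_mul_comm, ← mul_assoc,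
      tr_mul_diagonal u _ fun i => opFun_apply_eigenvector _ hA.1 (hu i)]
    refine Finset.sum_congr rfl fun i _ => ?_
    -- Commutation enters here: it turns `B L` into `√L B √L`, whose quadratic form has nonnegative
    -- weights.
    rw [← hCC, ← mul_assoc, hBC, mul_assoc, mul_apply_eq_comp C,
      ← inner_apply_of_isSelfAdjoint hC1, mul_apply_eq_comp, inner_apply_diagonal v hv,
      Finset.mul_sum]
    exact Finset.sum_congr rfl fun j _ => by ring
  rw [mul_sub, tr_sub, e1, e2, e3, e4, ← Finset.sum_sub_distrib, ← Finset.sum_sub_distrib]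
  refine Finset.sum_le_sum fun i _ => ?_
  rw [← Finset.sum_sub_distrib, ← Finset.sum_sub_distrib]
  refine Finset.sum_le_sum fun j _ => ?_
  have ha := hA.eigenvalue_pos hu i
  have hβ := hB.eigenvalue_pos hv j
  have h1 := Real.log_le_sub_one_of_pos (div_pos hβ ha)
  rw [Real.log_div hβ.ne' ha.ne'] at h1
  have h2 := mul_le_mul_of_nonneg_right h1 (sq_nonneg ⟪v j, C (u i)⟫_ℝ)
  rw [div_eq_inv_mul] at h2
  linarith

/-- The tangent bound `ln t ≤ 2 (ln s + √t / s - 1)` for operators. -/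
lemma tr_mul_log_le {N L : X →L[ℝ] X} (hN : IsPosDef N) (hL : IsPosDef L) {s : ℝ} (hs : 0 < s) :
    tr (L * opFun Real.log N)
      ≤ 2 * (tr L * Real.log s + tr L * tr (sqrtOp N) / s) := by
  obtain ⟨u, a, hu⟩ := exists_eigenbasis hN.1
  have h1 : tr (L * opFun Real.log N) ≤ 2 * (tr L * Real.log s + tr (L * sqrtOp N) / s) := by
    rw [tr_mul_diagonal u L fun i => opFun_apply_eigenvector _ hN.1 (hu i), sqrtOp,
      tr_mul_diagonal u L fun i => opFun_apply_eigenvector _ hN.1 (hu i), tr_eq_sum u L,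
      Finset.sum_mul, Finset.sum_div, ← Finset.sum_add_distrib, Finset.mul_sum]
    refine Finset.sum_le_sum fun i _ => ?_
    have ha := hN.eigenvalue_pos hu i
    have hsq := Real.sqrt_pos.2 ha
    have h2 := Real.log_le_sub_one_of_pos (div_pos hsq hs)
    rw [Real.log_div hsq.ne' hs.ne', Real.log_sqrt ha.le] at h2
    have h3 := mul_le_mul_of_nonneg_right (show Real.log (a i) ≤
      2 * (Real.log s + Real.sqrt (a i) / s) by linarith) (hL.nonneg (u i))
    refine h3.trans_eq ?_
    ring
  refine h1.trans ?_
  have h4 := tr_mul_le_tr_mul_tr hL.1 hL.nonneg (isPosDef_sqrtOp hN).nonneg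
  gcongr

/-! ### Lipschitz continuity of the inverse square root -/

lemma opNorm_le_of_diagonal {ι : Type*} [Fintype ι] (b : OrthonormalBasis ι ℝ X)
    {T : X →L[ℝ] X} {a : ι → ℝ} (h : ∀ i, T (b i) = a i • b i) {c : ℝ} (hc : 0 ≤ c)
    (ha : ∀ i, |a i| ≤ c) : ‖T‖ ≤ c := by
  refine T.opNorm_le_bound hc fun x => ?_
  refine abs_le_of_sq_le_sq' ?_ (by positivity) |>.2
  rw [← sum_sq_inner_left b, mul_pow, ← sum_sq_inner_left b, Finset.mul_sum]
  refine Finset.sum_le_sum fun i _ => ?_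
  rw [← inner_apply_of_isSelfAdjoint (isSelfAdjoint_of_diagonal b h), h, real_inner_smul_left,
    mul_pow]
  exact mul_le_mul_of_nonneg_right (sq_le_sq.2 (by rw [abs_of_nonneg hc]; exact ha i))
    (sq_nonneg _)

/-- The positive definite operators with spectrum in `[δ, ∞)`. -/
def posDefGE (δ : ℝ) : Set (X →L[ℝ] X) :=
  {T | IsPosDef T ∧ ∀ x, δ * ‖x‖ ^ 2 ≤ ⟪x, T x⟫_ℝ}

lemma le_eigenvalue_of_mem_posDefGE {ι : Type*} [Fintype ι] {b : OrthonormalBasis ι ℝ X}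
    {T : X →L[ℝ] X} {a : ι → ℝ} {δ : ℝ} (hT : T ∈ posDefGE δ) (h : ∀ i, T (b i) = a i • b i)
    (i : ι) : δ ≤ a i := by
  rw [eigenvalue_eq_inner b h]
  simpa [b.norm_eq_one] using hT.2 (b i)

lemma norm_invSqrtOp_le {δ : ℝ} (hδ : 0 < δ) {T : X →L[ℝ] X} (hT : T ∈ posDefGE δ) :
    ‖invSqrtOp T‖ ≤ (Real.sqrt δ)⁻¹ := by
  obtain ⟨b, a, h⟩ := exists_eigenbasis hT.1.1
  refine opNorm_le_of_diagonal b (fun i => opFun_apply_eigenvector _ hT.1.1 (h i)) (by positivity)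
    fun i => ?_
  rw [abs_of_nonneg (by positivity)]
  exact inv_anti₀ (Real.sqrt_pos.2 hδ) (Real.sqrt_le_sqrt (le_eigenvalue_of_mem_posDefGE hT h i))

lemma sqrtOp_mem_posDefGE {δ : ℝ} {T : X →L[ℝ] X} (hT : T ∈ posDefGE δ) :
    sqrtOp T ∈ posDefGE (Real.sqrt δ) := by
  refine ⟨isPosDef_sqrtOp hT.1, fun x => ?_⟩
  obtain ⟨b, a, h⟩ := exists_eigenbasis hT.1.1
  rw [sqrtOp, inner_apply_diagonal b fun i => opFun_apply_eigenvector _ hT.1.1 (h i),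
    ← sum_sq_inner_left b, Finset.mul_sum]
  exact Finset.sum_le_sum fun i _ => mul_le_mul_of_nonneg_right
    (Real.sqrt_le_sqrt (le_eigenvalue_of_mem_posDefGE hT h i)) (sq_nonneg _)

/-- On a unit eigenvector `u` of `√S - √T` with eigenvalue `a`, `⟨u, (S - T) u⟩ = a (⟨u, √S u⟩ + ⟨u,
√T u⟩)`, and the bracket is at least `2√δ`. -/
lemma norm_sqrtOp_sub_le {δ : ℝ} (hδ : 0 < δ) {S T : X →L[ℝ] X} (hS : S ∈ posDefGE δ)
    (hT : T ∈ posDefGE δ) : ‖sqrtOp S - sqrtOp T‖ ≤ (2 * Real.sqrt δ)⁻¹ * ‖S - T‖ := by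
  have hS' := sqrtOp_mem_posDefGE hS
  have hT' := sqrtOp_mem_posDefGE hT
  have hδ' := Real.sqrt_pos.2 hδ
  obtain ⟨b, a, h⟩ := exists_eigenbasis (hS'.1.1.sub hT'.1.1)
  refine opNorm_le_of_diagonal b h (by positivity) fun i => ?_
  rw [inv_mul_eq_div, le_div_iff₀ (by positivity)]
  have h1 : ⟪b i, (S - T) (b i)⟫_ℝ
      = a i * (⟪b i, sqrtOp S (b i)⟫_ℝ + ⟪b i, sqrtOp T (b i)⟫_ℝ) := by
    have h2 := h i
    rw [_root_.sub_apply, sub_eq_iff_eq_add] at h2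
    have h3 : ‖sqrtOp S (b i)‖ ^ 2 = a i ^ 2 + 2 * a i * ⟪b i, sqrtOp T (b i)⟫_ℝ
        + ‖sqrtOp T (b i)‖ ^ 2 := by
      rw [h2, norm_add_sq_real, norm_smul, b.norm_eq_one, real_inner_smul_left]
      simp only [mul_one, Real.norm_eq_abs, sq_abs]; ring
    have h4 : ⟪b i, sqrtOp S (b i)⟫_ℝ = a i + ⟪b i, sqrtOp T (b i)⟫_ℝ := by
      rw [h2, inner_add_right, real_inner_smul_right, real_inner_self_eq_norm_sq, b.norm_eq_one]
      ring
    nth_rewrite 1 [← sqrtOp_mul_self hS.1, ← sqrtOp_mul_self hT.1]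
    rw [_root_.sub_apply, inner_sub_right, inner_mul_self hS'.1.1, inner_mul_self hT'.1.1, h3, h4]
    ring
  have h2 : |⟪b i, (S - T) (b i)⟫_ℝ| ≤ ‖S - T‖ := by
    refine (abs_real_inner_le_norm _ _).trans ?_
    have := (S - T).le_opNorm (b i)
    rw [b.norm_eq_one] at this ⊢
    linarith
  have h3 := hS'.2 (b i)
  have h4 := hT'.2 (b i)
  rw [b.norm_eq_one] at h3 h4
  rw [h1, abs_mul, abs_of_nonneg (a := _ + _) (by linarith)] at h2
  refine le_trans (mul_le_mul_of_nonneg_left ?_ (abs_nonneg _)) h2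
  linarith

lemma continuousOn_invSqrtOp {δ : ℝ} (hδ : 0 < δ) :
    ContinuousOn (invSqrtOp : (X →L[ℝ] X) → (X →L[ℝ] X)) (posDefGE δ) := by
  have hδ' := Real.sqrt_pos.2 hδ
  refine LipschitzOnWith.continuousOn (K := Real.toNNReal ((Real.sqrt δ)⁻¹ * (2 * Real.sqrt δ)⁻¹
    * (Real.sqrt δ)⁻¹)) (LipschitzOnWith.of_dist_le_mul fun S hS T hT => ?_)
  rw [dist_eq_norm, dist_eq_norm, Real.coe_toNNReal _ (by positivity)]
  have h1 : invSqrtOp S - invSqrtOp T = invSqrtOp S * (sqrtOp T - sqrtOp S) * invSqrtOp T := by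
    rw [mul_sub, sub_mul, mul_assoc, sqrtOp_mul_invSqrtOp hT.1, invSqrtOp_mul_sqrtOp hS.1, mul_one,
      one_mul]
  rw [h1]
  refine (norm_mul_le _ _).trans ?_
  have h2 := norm_sqrtOp_sub_le hδ hS hT
  rw [norm_sub_rev] at h2
  calc ‖invSqrtOp S * (sqrtOp T - sqrtOp S)‖ * ‖invSqrtOp T‖
      ≤ (Real.sqrt δ)⁻¹ * ((2 * Real.sqrt δ)⁻¹ * ‖S - T‖) * (Real.sqrt δ)⁻¹ := by
        gcongr
        · refine (norm_mul_le _ _).trans ?_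
          gcongr
          exact norm_invSqrtOp_le hδ hS
        · exact norm_invSqrtOp_le hδ hT
    _ = _ := by ring

/-- Continuity is available only on `posDefGE δ`, so the map is factored through that subtype. This
is how the iterates are seen to be measurable. -/
lemma measurable_invSqrtOp {Ω : Type*} [MeasurableSpace Ω] {δ : ℝ} (hδ : 0 < δ)
    {N : Ω → X →L[ℝ] X} (hN : Measurable N) (h : ∀ ω, N ω ∈ posDefGE δ) :
    Measurable fun ω => invSqrtOp (N ω) := by
  have h1 : Continuous ((posDefGE δ).domRestrict (invSqrtOp : (X →L[ℝ] X) → (X →L[ℝ] X))) :=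
    continuousOn_iff_continuous_domRestrict.1 (continuousOn_invSqrtOp hδ)
  have h2 : Measurable fun ω => (⟨N ω, h ω⟩ : posDefGE (X := X) δ) := hN.subtype_mk
  have h3 : Measurable ((posDefGE δ).domRestrict (invSqrtOp : (X →L[ℝ] X) → (X →L[ℝ] X))) := h1.measurable
  simpa only [Function.comp_def, Set.domRestrict_apply] using h3.comp h2

end SquareRoots

/-! ### Preconditioners: closed forms and potentials -/

noncomputable section Preconditioners

variable {X : Type u} [NormedAddCommGroup X] [InnerProductSpace ℝ X] [FiniteDimensional ℝ X]
  {𝓗 : Submodule ℝ (X →L[ℝ] X)}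

/-! ### The space of preconditioners and its orthogonal projection -/

lemma proj_mem (𝓗 : Submodule ℝ (X →L[ℝ] X)) (S : X →L[ℝ] X) : proj 𝓗 S ∈ 𝓗 :=
  Submodule.projection_apply_mem _ _

lemma proj_of_mem {S : X →L[ℝ] X} (hS : S ∈ 𝓗) : proj 𝓗 S = S :=
  Submodule.projection_apply_left (isCompl_frob 𝓗) ⟨S, hS⟩

lemma frob_proj {A : X →L[ℝ] X} (hA : A ∈ 𝓗) (S : X →L[ℝ] X) :
    frob A (proj 𝓗 S) = frob A S := by
  have h1 : S - proj 𝓗 S ∈ frob.orthogonal 𝓗 :=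
    Submodule.sub_projection_mem (isCompl_frob 𝓗) S
  have h2 : frob A (S - proj 𝓗 S) = 0 := h1 A hA
  rw [map_sub] at h2
  linarith

lemma frob_eq_tr (A : X →L[ℝ] X) {S : X →L[ℝ] X} (hS : IsSelfAdjoint S) :
    frob A S = tr (A * S) := by
  rw [frob_apply, ContinuousLinearMap.isSelfAdjoint_iff'.1 hS]

lemma IsPrecondSpace.tr_mul_proj (h : IsPrecondSpace 𝓗) {A : X →L[ℝ] X} (hA : A ∈ 𝓗)
    {S : X →L[ℝ] X} (hS : IsSelfAdjoint S) : tr (A * proj 𝓗 S) = tr (A * S) := by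
  rw [← frob_eq_tr A hS, ← frob_proj hA, frob_eq_tr A (h.selfAdjoint _ (proj_mem 𝓗 S))]

lemma IsPrecondSpace.one_mem (h : IsPrecondSpace 𝓗) : (1 : X →L[ℝ] X) ∈ 𝓗 := by
  have := h.opFun_mem 0 𝓗.zero_mem fun _ => 1
  rwa [opFun_const_one (IsSelfAdjoint.zero _)] at this

/-- Polarisation: `𝓗` is closed under squares, being closed under operator functions, and `2 S T =
(S + T)² - S² - T²` for commuting `S` and `T`. -/
lemma IsPrecondSpace.mul_mem (h : IsPrecondSpace 𝓗) {S T : X →L[ℝ] X} (hS : S ∈ 𝓗) (hT : T ∈ 𝓗)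
    (hST : S * T = T * S) : S * T ∈ 𝓗 := by
  have hsq : ∀ A ∈ 𝓗, A * A ∈ 𝓗 := fun A hA => by
    rw [← opFun_sq (h.selfAdjoint A hA)]
    exact h.opFun_mem A hA _
  have h1 := 𝓗.sub_mem (𝓗.sub_mem (hsq _ (𝓗.add_mem hS hT)) (hsq S hS)) (hsq T hT)
  have h2 : S * T = (2⁻¹ : ℝ) • ((S + T) * (S + T) - S * S - T * T) := by
    have : (S + T) * (S + T) - S * S - T * T = (2 : ℝ) • (S * T) := by
      rw [add_mul, mul_add, mul_add, ← hST, two_smul]; abel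
    rw [this, smul_smul]; norm_num
  rw [h2]
  exact 𝓗.smul_mem _ h1

/-- The assumption concerns definite operators only; perturb `S` by a small multiple of the
identity, which the projection fixes, and let the multiple shrink. -/
lemma IsPrecondSpace.inner_proj_nonneg (h : IsPrecondSpace 𝓗) {S : X →L[ℝ] X}
    (hS : IsSelfAdjoint S) (h0 : ∀ x, 0 ≤ ⟪x, S x⟫_ℝ) (x : X) : 0 ≤ ⟪x, proj 𝓗 S x⟫_ℝ := by
  refine le_of_forall_pos_le_add fun ε hε => ?_
  set c := ε / (‖x‖ ^ 2 + 1) with hc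
  have hc0 : 0 < c := by positivity
  have hpd : IsPosDef (S + c • (1 : X →L[ℝ] X)) := by
    refine ⟨hS.add (isPosDef_smul isPosDef_one hc0).1, fun y hy => ?_⟩
    rw [_root_.add_apply, inner_add_right]
    exact add_pos_of_nonneg_of_pos (h0 y) ((isPosDef_smul isPosDef_one hc0).2 y hy)
  have h1 := (h.proj_posDef _ hpd).nonneg x
  rw [map_add, map_smul, proj_of_mem h.one_mem, _root_.add_apply, inner_add_right,
    _root_.smul_apply, real_inner_smul_right, one_apply_eq_self, real_inner_self_eq_norm_sq] at h1
  have h2 : c * ‖x‖ ^ 2 ≤ ε := by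
    rw [hc, div_mul_eq_mul_div, div_le_iff₀ (by positivity)]
    nlinarith
  linarith

/-- The regularised accumulator `δ I + proj_𝓗 S`. -/
def accum (𝓗 : Submodule ℝ (X →L[ℝ] X)) (δ : ℝ) (S : X →L[ℝ] X) : X →L[ℝ] X :=
  δ • (1 : X →L[ℝ] X) + proj 𝓗 S

lemma IsPrecondSpace.accum_mem (h : IsPrecondSpace 𝓗) (δ : ℝ) (S : X →L[ℝ] X) :
    accum 𝓗 δ S ∈ 𝓗 :=
  𝓗.add_mem (𝓗.smul_mem _ h.one_mem) (proj_mem 𝓗 S)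

lemma IsPrecondSpace.accum_mem_posDefGE (h : IsPrecondSpace 𝓗) {δ : ℝ} (hδ : 0 < δ)
    {S : X →L[ℝ] X} (hS : IsSelfAdjoint S) (h0 : ∀ x, 0 ≤ ⟪x, S x⟫_ℝ) :
    accum 𝓗 δ S ∈ posDefGE δ := by
  have h1 : ∀ x, δ * ‖x‖ ^ 2 ≤ ⟪x, accum 𝓗 δ S x⟫_ℝ := fun x => by
    rw [accum, _root_.add_apply, inner_add_right, _root_.smul_apply, real_inner_smul_right,
      one_apply_eq_self, real_inner_self_eq_norm_sq]
    linarith [h.inner_proj_nonneg hS h0 x]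
  refine ⟨⟨h.selfAdjoint _ (h.accum_mem δ S), fun x hx => ?_⟩, h1⟩
  exact lt_of_lt_of_le (mul_pos hδ (pow_pos (norm_pos_iff.2 hx) 2)) (h1 x)

/-! ### Closed forms for the two minimisation problems -/

lemma opFun_potential {H : X →L[ℝ] X} (hH : IsSelfAdjoint H) (δ η : ℝ) :
    opFun (potential δ η) H = δ • H + η ^ 2 • opFun (fun t => t⁻¹) H := by
  obtain ⟨b, a, h⟩ := exists_eigenbasis hH
  refine ext_orthonormalBasis b fun i => ?_
  rw [opFun_apply_eigenvector _ hH (h i), _root_.add_apply, _root_.smul_apply, _root_.smul_apply,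
    opFun_apply_eigenvector _ hH (h i), h, smul_smul, smul_smul, ← add_smul, potential,
    div_eq_mul_inv]

lemma IsPrecondSpace.precondObj_eq (h : IsPrecondSpace 𝓗) (δ η : ℝ) {S : X →L[ℝ] X}
    (hS : IsSelfAdjoint S) {H : X →L[ℝ] X} (hH : H ∈ 𝓗) :
    precondObj δ η S H = tr (H * accum 𝓗 δ S) + η ^ 2 * tr (opFun (fun t => t⁻¹) H) := by
  have hsa := h.selfAdjoint H hH
  rw [precondObj, frob_eq_tr _ hS, frob_eq_tr _ (isSelfAdjoint_opFun _ hsa), one_mul,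
    opFun_potential hsa, tr_add, tr_smul, tr_smul, accum, mul_add, tr_add, h.tr_mul_proj hH hS,
    mul_smul_comm, mul_one, tr_smul]
  ring

lemma opFun_inv_smul_invSqrtOp {N : X →L[ℝ] X} (hN : IsPosDef N) {η : ℝ} (hη : 0 < η) :
    opFun (fun t => t⁻¹) (η • invSqrtOp N) = η⁻¹ • sqrtOp N := by
  have h1 := opFun_inv_mul (isPosDef_smul (isPosDef_invSqrtOp hN) hη)
  calc _ = opFun (fun t => t⁻¹) (η • invSqrtOp N) * ((η • invSqrtOp N) * (η⁻¹ • sqrtOp N)) := by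
        rw [smul_mul_smul_comm, mul_inv_cancel₀ hη.ne', one_smul, invSqrtOp_mul_sqrtOp hN, mul_one]
    _ = _ := by rw [← mul_assoc, h1, one_mul]

/-- The preconditioner is `η (δ I + proj_𝓗 S) ^ (-1/2)`. -/
lemma IsPreconditioner.eq_smul_invSqrtOp (h : IsPrecondSpace 𝓗) {δ η : ℝ} (hδ : 0 < δ)
    (hη : 0 < η) {S H : X →L[ℝ] X} (hS : IsSelfAdjoint S) (h0 : ∀ x, 0 ≤ ⟪x, S x⟫_ℝ)
    (hH : IsPreconditioner 𝓗 δ η S H) : H = η • invSqrtOp (accum 𝓗 δ S) := by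
  set N := accum 𝓗 δ S with hNdef
  have hN : IsPosDef N := (h.accum_mem_posDefGE hδ hS h0).1
  have hWmem : η • invSqrtOp N ∈ 𝓗 := 𝓗.smul_mem _ (h.opFun_mem _ (h.accum_mem δ S) _)
  have h1 := hH.2 _ hWmem (isPosDef_smul (isPosDef_invSqrtOp hN) hη)
  obtain ⟨⟨hHm, hHp⟩, -⟩ := hH
  rw [h.precondObj_eq δ η hS hHm, h.precondObj_eq δ η hS hWmem, opFun_inv_smul_invSqrtOp hN hη,
    ← hNdef] at h1
  set M := sqrtOp N with hM
  have hMM : M * M = N := sqrtOp_mul_self hN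
  have hWN : invSqrtOp N * N = M := by
    calc invSqrtOp N * N = invSqrtOp N * (M * M) := by rw [hMM]
      _ = M := by rw [← mul_assoc, invSqrtOp_mul_sqrtOp hN, one_mul]
  rw [smul_mul_assoc, hWN, tr_smul, tr_smul] at h1
  set C := sqrtOp H with hC
  set E := invSqrtOp H with hE
  have hCC : C * C = H := sqrtOp_mul_self hHp
  have hEE : E * E = opFun (fun t => t⁻¹) H := invSqrtOp_mul_self hHp
  have hCE : C * E = 1 := sqrtOp_mul_invSqrtOp hHp
  have hEC : E * C = 1 := invSqrtOp_mul_sqrtOp hHp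
  have hMs : ContinuousLinearMap.adjoint M = M := ContinuousLinearMap.isSelfAdjoint_iff'.1 (isPosDef_sqrtOp hN).1
  have hCs : ContinuousLinearMap.adjoint C = C := ContinuousLinearMap.isSelfAdjoint_iff'.1 (isPosDef_sqrtOp hHp).1
  have hEs : ContinuousLinearMap.adjoint E = E := ContinuousLinearMap.isSelfAdjoint_iff'.1 (isPosDef_invSqrtOp hHp).1
  have hadj : ContinuousLinearMap.adjoint (M * C - η • E) = C * M - η • E := by
    rw [map_sub, ← ContinuousLinearMap.star_eq_adjoint, star_mul,
      ContinuousLinearMap.star_eq_adjoint, ContinuousLinearMap.star_eq_adjoint, hMs, hCs]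
    simp [hEs]
  -- The square being completed: the objective at `H` exceeds `2 η tr √N`, its value at the
  -- candidate, by `‖√N √H - η H^(-1/2)‖²`. At a minimiser this square must vanish, which determines
  -- `H`.
  have hsq : frob (M * C - η • E) (M * C - η • E)
      = tr (H * N) - 2 * η * tr M + η ^ 2 * tr (opFun (fun t => t⁻¹) H) := by
    rw [frob_apply, hadj, mul_sub, sub_mul, sub_mul, tr_sub, tr_sub, tr_sub, ← hEE]
    have e1 : tr (M * C * (C * M)) = tr (H * N) := by
      rw [mul_assoc, ← mul_assoc C, hCC, tr_mul_comm, mul_assoc, hMM]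
    have e2 : tr (η • E * (C * M)) = η * tr M := by
      rw [smul_mul_assoc, ← mul_assoc, hEC, one_mul, tr_smul]
    have e3 : tr (M * C * (η • E)) = η * tr M := by
      rw [mul_smul_comm, mul_assoc, hCE, mul_one, tr_smul]
    rw [e1, e2, e3, smul_mul_smul_comm, tr_smul]
    ring
  have hzero : M * C - η • E = 0 := by
    refine eq_zero_of_frob_self (le_antisymm ?_ ?_)
    · rw [hsq]
      have : η ^ 2 * (η⁻¹ * tr M) = η * tr M := by field_simp
      linarith
    · rw [frob_eq_sum]
      exact Finset.sum_nonneg fun _ _ => real_inner_self_nonneg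
  have h2 : M * H = η • 1 := by
    rw [← hCC, ← mul_assoc, sub_eq_zero.1 hzero, smul_mul_assoc, hEC]
  calc H = invSqrtOp N * (M * H) := by rw [← mul_assoc, invSqrtOp_mul_sqrtOp hN, one_mul]
    _ = _ := by rw [h2, mul_smul_comm, mul_one]

/-- The preconditioned gradient step is `x - H g`. -/
lemma IsPrecondStep.eq_sub {H : X →L[ℝ] X} (hH : IsPosDef H) {g x y : X}
    (h : IsPrecondStep H g x y) : y = x - H g := by
  have hI := isPosDef_inverse hH
  -- Comparison with the candidate leaves exactly `½ ⟨w, H⁻¹ w⟩ ≤ 0` for the displacement `w = y -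
  -- (x - H g)`, hence `w = 0`.
  have h1 := h (x - H g)
  rw [wnorm_sq hI, wnorm_sq hI] at h1
  set V := Ring.inverse H with hV
  have hVH : ∀ z, V (H z) = z := fun z => by
    rw [← mul_apply_eq_comp, Ring.inverse_mul_cancel _ hH.isUnit]; rfl
  set w := y - x + H g with hw
  have hy : y - x = w - H g := by rw [hw]; abel
  have hy' : y = w + (x - H g) := by rw [hw]; abel
  have hx : x - H g - x = -H g := by abel
  have h2 : ⟪H g, V w⟫_ℝ = ⟪g, w⟫_ℝ := by
    rw [← inner_apply_of_isSelfAdjoint hI.1, hVH]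
  have h3 : ⟪w, g⟫_ℝ = ⟪g, w⟫_ℝ := real_inner_comm _ _
  rw [hx, hy] at h1
  simp only [map_sub, map_neg, hVH, inner_sub_left, inner_sub_right, inner_neg_left,
    inner_neg_right, h2, h3] at h1
  rw [hy', inner_add_right, inner_sub_right] at h1
  have h4 : ⟪w, V w⟫_ℝ ≤ 0 := by linarith
  have h5 : w = 0 := by
    by_contra hne
    exact absurd (hI.2 w hne) (not_lt.2 h4)
  rw [hy', h5, zero_add]

/-! ### Potentials along a sequence of gradients -/

/-- The regularised accumulator of the gradients `g 0, …, g (k - 1)`. -/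
def gradAccum (𝓗 : Submodule ℝ (X →L[ℝ] X)) (δ : ℝ) (g : ℕ → X) (k : ℕ) : X →L[ℝ] X :=
  accum 𝓗 δ (∑ i ∈ Finset.range k, rankOneOp (g i) (g i))

lemma isSelfAdjoint_sum_rankOneOp (g : ℕ → X) (k : ℕ) :
    IsSelfAdjoint (∑ i ∈ Finset.range k, rankOneOp (g i) (g i)) := by
  induction k with
  | zero => simp
  | succ k ih => rw [Finset.sum_range_succ]; exact ih.add (isSelfAdjoint_rankOneOp _)

lemma inner_sum_rankOneOp_nonneg (g : ℕ → X) (k : ℕ) (x : X) :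
    0 ≤ ⟪x, (∑ i ∈ Finset.range k, rankOneOp (g i) (g i)) x⟫_ℝ := by
  rw [_root_.sum_apply, inner_sum]
  exact Finset.sum_nonneg fun i _ => by rw [inner_rankOneOp]; positivity

lemma IsPrecondSpace.gradAccum_mem (h : IsPrecondSpace 𝓗) (δ : ℝ) (g : ℕ → X) (k : ℕ) :
    gradAccum 𝓗 δ g k ∈ 𝓗 :=
  h.accum_mem δ _

lemma IsPrecondSpace.gradAccum_mem_posDefGE (h : IsPrecondSpace 𝓗) {δ : ℝ} (hδ : 0 < δ)
    (g : ℕ → X) (k : ℕ) : gradAccum 𝓗 δ g k ∈ posDefGE δ :=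
  h.accum_mem_posDefGE hδ (isSelfAdjoint_sum_rankOneOp g k) (inner_sum_rankOneOp_nonneg g k)

lemma gradAccum_zero (δ : ℝ) (g : ℕ → X) : gradAccum 𝓗 δ g 0 = δ • (1 : X →L[ℝ] X) := by
  simp [gradAccum, accum]

lemma gradAccum_succ_sub (δ : ℝ) (g : ℕ → X) (k : ℕ) :
    gradAccum 𝓗 δ g (k + 1) - gradAccum 𝓗 δ g k = proj 𝓗 (rankOneOp (g k) (g k)) := by
  rw [gradAccum, gradAccum, accum, accum, Finset.sum_range_succ, map_add]
  abel

lemma IsPrecondSpace.inner_gradAccum_le_succ (h : IsPrecondSpace 𝓗) (δ : ℝ) (g : ℕ → X) (k : ℕ)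
    (x : X) : ⟪x, gradAccum 𝓗 δ g k x⟫_ℝ ≤ ⟪x, gradAccum 𝓗 δ g (k + 1) x⟫_ℝ := by
  have h1 := h.inner_proj_nonneg (isSelfAdjoint_rankOneOp (g k))
    (fun x => by rw [inner_rankOneOp]; positivity) x
  rw [← gradAccum_succ_sub δ g k, _root_.sub_apply, inner_sub_right] at h1
  linarith

lemma IsPrecondSpace.tr_mul_gradAccum_sub (h : IsPrecondSpace 𝓗) {A : X →L[ℝ] X} (hA : A ∈ 𝓗)
    (δ : ℝ) (g : ℕ → X) (k : ℕ) :
    tr (A * (gradAccum 𝓗 δ g (k + 1) - gradAccum 𝓗 δ g k)) = ⟪g k, A (g k)⟫_ℝ := by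
  rw [gradAccum_succ_sub, h.tr_mul_proj hA (isSelfAdjoint_rankOneOp _), tr_mul_rankOneOp]

lemma opFun_smul_one (ψ : ℝ → ℝ) (δ : ℝ) :
    opFun ψ (δ • (1 : X →L[ℝ] X)) = ψ δ • (1 : X →L[ℝ] X) := by
  have hsa : IsSelfAdjoint (δ • (1 : X →L[ℝ] X)) :=
    isSelfAdjoint_of_inner fun x y => by simp [real_inner_smul_left, real_inner_smul_right]
  refine ContinuousLinearMap.ext fun x => ?_
  rw [opFun_apply_eigenvector ψ hsa (a := δ) (by simp)]
  simp

/-- With `A = N (k+1)` and `B = N k`, each summand is `tr (A^(-1/2) (A - B)) = tr √A - tr (A^(-1/2)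
B)`. Since `√B ≤ √A`, the last trace is at most `tr √B`, so the sum telescopes from `N 0 = δ I`. -/
lemma IsPrecondSpace.tr_sqrtOp_le_sum (h : IsPrecondSpace 𝓗) {δ : ℝ} (hδ : 0 < δ) (g : ℕ → X)
    (n : ℕ) : tr (sqrtOp (gradAccum 𝓗 δ g n)) - Real.sqrt δ * Module.finrank ℝ X
      ≤ ∑ k ∈ Finset.range n, ⟪g k, invSqrtOp (gradAccum 𝓗 δ g (k + 1)) (g k)⟫_ℝ := by
  induction n with
  | zero => simp [gradAccum_zero, sqrtOp, opFun_smul_one, tr_smul, tr_one]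
  | succ n ih =>
    rw [Finset.sum_range_succ]
    have hA := (h.gradAccum_mem_posDefGE hδ g (n + 1)).1
    have hB := (h.gradAccum_mem_posDefGE hδ g n).1
    have h1 := h.tr_mul_gradAccum_sub (h.opFun_mem _ (h.gradAccum_mem δ g (n + 1))
      (fun t => (Real.sqrt t)⁻¹)) δ g n
    change tr (invSqrtOp (gradAccum 𝓗 δ g (n + 1)) * _)
      = ⟪g n, invSqrtOp (gradAccum 𝓗 δ g (n + 1)) (g n)⟫_ℝ at h1
    rw [mul_sub, tr_sub] at h1
    nth_rewrite 2 [← sqrtOp_mul_self hA] at h1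
    rw [← mul_assoc, invSqrtOp_mul_sqrtOp hA, one_mul] at h1
    have h2 := tr_mul_mul_self_le (sqrtOp_mul_invSqrtOp hA) (isPosDef_sqrtOp hB).1
      (isPosDef_sqrtOp hB).nonneg (inner_sqrtOp_mono hA hB (h.inner_gradAccum_le_succ δ g n))
    rw [sqrtOp_mul_self hB] at h2
    linarith

/-- `⟨x, D x⟩ = tr (D x⟨x,·⟩)`, and because `D ∈ 𝓗` the rank-one operator may be replaced by its
projection. This is why the distance is measured through the projection. -/
lemma IsPrecondSpace.inner_le_mul_tr (h : IsPrecondSpace 𝓗) {D : X →L[ℝ] X} (hD : D ∈ 𝓗)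
    (h0 : ∀ x, 0 ≤ ⟪x, D x⟫_ℝ) {r : ℝ} {x : X} (hx : ‖proj 𝓗 (rankOneOp x x)‖ ≤ r) :
    ⟪x, D x⟫_ℝ ≤ r * tr D := by
  rw [← tr_mul_rankOneOp, ← h.tr_mul_proj hD (isSelfAdjoint_rankOneOp x)]
  exact (tr_mul_le_norm_mul_tr (h.selfAdjoint D hD) h0 _).trans
    (mul_le_mul_of_nonneg_right hx (tr_nonneg h0))

/-- Summation by parts: each weight increment `√(N (k+1)) - √(N k)` is positive semidefinite and
costs at most `r` times its trace, and the traces telescope. The final distance is kept on the left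
so that the induction closes. -/
lemma IsPrecondSpace.sum_inner_sqrtOp_sub_le (h : IsPrecondSpace 𝓗) {δ : ℝ} (hδ : 0 < δ)
    (g x : ℕ → X) {r : ℝ} (n : ℕ) (hx : ∀ k ≤ n, ‖proj 𝓗 (rankOneOp (x k) (x k))‖ ≤ r) :
    ∑ k ∈ Finset.range (n + 1), (⟪x k, sqrtOp (gradAccum 𝓗 δ g (k + 1)) (x k)⟫_ℝ
        - ⟪x (k + 1), sqrtOp (gradAccum 𝓗 δ g (k + 1)) (x (k + 1))⟫_ℝ)
      + ⟪x (n + 1), sqrtOp (gradAccum 𝓗 δ g (n + 1)) (x (n + 1))⟫_ℝ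
      ≤ r * tr (sqrtOp (gradAccum 𝓗 δ g (n + 1))) := by
  have hmem : ∀ k, sqrtOp (gradAccum 𝓗 δ g k) ∈ 𝓗 := fun k =>
    h.opFun_mem _ (h.gradAccum_mem δ g k) _
  have hpd : ∀ k, IsPosDef (gradAccum 𝓗 δ g k) := fun k => (h.gradAccum_mem_posDefGE hδ g k).1
  induction n with
  | zero =>
    have := h.inner_le_mul_tr (hmem 1) (isPosDef_sqrtOp (hpd 1)).nonneg (hx 0 le_rfl)
    simpa using this
  | succ n ih =>
    rw [Finset.sum_range_succ]
    have h1 := ih fun k hk => hx k (by omega)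
    have h2 := h.inner_le_mul_tr (𝓗.sub_mem (hmem (n + 2)) (hmem (n + 1))) (fun y => by
      rw [_root_.sub_apply, inner_sub_right]
      linarith [inner_sqrtOp_mono (hpd (n + 2)) (hpd (n + 1))
        (h.inner_gradAccum_le_succ δ g (n + 1)) y]) (hx (n + 1) le_rfl)
    rw [_root_.sub_apply, inner_sub_right, tr_sub] at h2
    linarith

/-- Since `L` commutes with `N`, each summand is `tr (L N⁻¹ ΔN)` for the increment `ΔN`, which
Klein's inequality bounds by the increment of `tr (L ln N)`. The free parameter `t` sets the
exchange between a logarithm and the trace of `√N`. -/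
lemma IsPrecondSpace.sum_weighted_le (h : IsPrecondSpace 𝓗) {δ : ℝ} (hδ : 0 < δ) (g : ℕ → X)
    {L : X →L[ℝ] X} (hLm : L ∈ 𝓗) (hL : IsPosDef L) (hLc : CommutesWith 𝓗 L) (n : ℕ) {t : ℝ}
    (ht : 0 < t) :
    ∑ k ∈ Finset.range n, ⟪invSqrtOp (gradAccum 𝓗 δ g (k + 1)) (g k),
        L (invSqrtOp (gradAccum 𝓗 δ g (k + 1)) (g k))⟫_ℝ
      ≤ 2 * (tr L * Real.log t + tr L * tr (sqrtOp (gradAccum 𝓗 δ g n)) / (Real.sqrt δ * t)) := by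
  have hpd : ∀ k, IsPosDef (gradAccum 𝓗 δ g k) := fun k => (h.gradAccum_mem_posDefGE hδ g k).1
  have h1 : ∑ k ∈ Finset.range n, ⟪invSqrtOp (gradAccum 𝓗 δ g (k + 1)) (g k),
        L (invSqrtOp (gradAccum 𝓗 δ g (k + 1)) (g k))⟫_ℝ
      ≤ tr (L * opFun Real.log (gradAccum 𝓗 δ g n)) - tr L * Real.log δ := by
    induction n with
    | zero => simp [gradAccum_zero, opFun_smul_one, tr_smul, mul_comm]
    | succ n ih =>
      rw [Finset.sum_range_succ]
      have hN := hpd (n + 1)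
      have hinv : opFun (fun t => t⁻¹) (gradAccum 𝓗 δ g (n + 1)) ∈ 𝓗 :=
        h.opFun_mem _ (h.gradAccum_mem δ g (n + 1)) _
      have hW : invSqrtOp (gradAccum 𝓗 δ g (n + 1)) ∈ 𝓗 :=
        h.opFun_mem _ (h.gradAccum_mem δ g (n + 1)) _
      have h2 := tr_mul_inv_mul_sub_le hN (hpd n) hL (hLc _ (h.gradAccum_mem δ g n)).symm
      -- `L N⁻¹` lies in `𝓗` as a product of commuting elements, so the projection inside the
      -- increment can be dropped.
      rw [h.tr_mul_gradAccum_sub (h.mul_mem hLm hinv (hLc _ hinv)), ← invSqrtOp_mul_self hN,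
        ← mul_assoc, hLc _ hW, mul_assoc, mul_apply_eq_comp,
        ← inner_apply_of_isSelfAdjoint (isPosDef_invSqrtOp hN).1, mul_apply_eq_comp] at h2
      linarith
  have hs := Real.sqrt_pos.2 hδ
  -- The choice `s = √δ t` cancels the initial value `tr L ln δ`.
  have h2 := tr_mul_log_le (hpd n) hL (mul_pos hs ht)
  rw [Real.log_mul hs.ne' ht.ne', Real.log_sqrt hδ.le] at h2
  linarith

end Preconditioners

/-! ### Deterministic analysis of one run -/

noncomputable section Pathwise

variable {X : Type u} [NormedAddCommGroup X] [InnerProductSpace ℝ X] [FiniteDimensional ℝ X]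
  {𝓗 : Submodule ℝ (X →L[ℝ] X)}

/-- Young's inequality for the Hölder smoothness term. -/
lemma holder_term_le {ν p q τ z : ℝ} (hν0 : 0 ≤ ν) (hν1 : ν ≤ 1) (hp : 0 < p) (hq : 0 < q)
    (hpq : p ^ ((1 + ν) / 2) * q ^ ((1 - ν) / 2) = 1) (hτ : 0 ≤ τ) (hz : 0 ≤ z) :
    1 / (1 + ν) * τ ^ ((1 - ν) / 2) * z ^ (1 + ν) ≤ p * z ^ 2 / 2 + q * τ / 2 := by
  have h1 := Real.geom_mean_le_arith_mean2_weighted (w₁ := (1 + ν) / 2) (w₂ := (1 - ν) / 2)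
    (p₁ := p * z ^ 2) (p₂ := q * τ) (by linarith) (by linarith) (by positivity) (by positivity)
    (by ring)
  have h2 : (p * z ^ 2) ^ ((1 + ν) / 2) * (q * τ) ^ ((1 - ν) / 2)
      = τ ^ ((1 - ν) / 2) * z ^ (1 + ν) := by
    rw [Real.mul_rpow hp.le (by positivity), Real.mul_rpow hq.le hτ, ← Real.rpow_natCast z 2,
      ← Real.rpow_mul hz]
    have : ((2 : ℕ) : ℝ) * ((1 + ν) / 2) = 1 + ν := by push_cast; ring
    rw [this]
    calc _ = (p ^ ((1 + ν) / 2) * q ^ ((1 - ν) / 2)) * (τ ^ ((1 - ν) / 2) * z ^ (1 + ν)) := by ring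
      _ = _ := by rw [hpq, one_mul]
  rw [h2] at h1
  have hν : 0 < 1 + ν := by linarith
  rw [mul_assoc, one_div, inv_mul_le_iff₀ hν]
  -- The weighted mean gives `(1 - ν)/2` in front of `q τ`; this term raises it to `(1 + ν)/2`.
  have h3 : 0 ≤ ν * (q * τ) := by positivity
  nlinarith

lemma wnorm_smul_sq {L : X →L[ℝ] X} (hL : IsPosDef L) (c : ℝ) (x : X) :
    wnorm L (c • x) ^ 2 = c ^ 2 * ⟪x, L x⟫_ℝ := by
  rw [wnorm_sq hL, map_smul, real_inner_smul_left, real_inner_smul_right]; ring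

/-- One step of the momentum recursion. -/
lemma IsHolderSmooth.momentum_step {L : X →L[ℝ] X} {ν : ℝ} {f : X → ℝ}
    (hf : IsHolderSmooth 𝓗 L ν f) (hν0 : 0 ≤ ν) (hν1 : ν ≤ 1) {p q : ℝ} (hp : 0 < p) (hq : 0 < q)
    (hpq : p ^ ((1 + ν) / 2) * q ^ ((1 - ν) / 2) = 1) {a : ℝ} (ha0 : 0 < a) (ha1 : a ≤ 1)
    {x xbar x' d n : X} (xs : X) (hd : IsSubgradient f (a • x + (1 - a) • xbar) d) :
    (a⁻¹) ^ 2 * (f (a • x' + (1 - a) • xbar) - f xs)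
      ≤ (1 - a) * (a⁻¹) ^ 2 * (f xbar - f xs) + ⟪a⁻¹ • (d + n), x' - xs⟫_ℝ
        - a⁻¹ * ⟪n, x' - xs⟫_ℝ + p / 2 * ⟪x' - x, L (x' - x)⟫_ℝ
        + q / 2 * tr L * (a⁻¹) ^ 2 := by
  have h1 := hd xs
  have h2 := hd xbar
  have h3 := (hf.smooth _ (a • x' + (1 - a) • xbar) _ hd).2
  have e1 : a • x' + (1 - a) • xbar - (a • x + (1 - a) • xbar) = a • (x' - x) := by
    rw [smul_sub]; abel
  rw [e1, trNorm_eq_tr hf.posDef] at h3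
  have h4 := holder_term_le hν0 hν1 hp hq hpq (tr_nonneg hf.posDef.nonneg)
    (show 0 ≤ wnorm L (a • (x' - x)) from Real.sqrt_nonneg _)
  rw [wnorm_smul_sq hf.posDef] at h4
  -- Weighting the subgradient inequalities at `xs` and `xbar` by `a` and `1 - a` cancels the
  -- average in the query point, leaving `a (xs - x)`.
  have e2 : a * ⟪d, xs - (a • x + (1 - a) • xbar)⟫_ℝ
      + (1 - a) * ⟪d, xbar - (a • x + (1 - a) • xbar)⟫_ℝ = a * (⟪d, xs⟫_ℝ - ⟪d, x⟫_ℝ) := by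
    simp only [inner_sub_right, inner_add_right, real_inner_smul_right]; ring
  have e3 : ⟪a⁻¹ • (d + n), x' - xs⟫_ℝ - a⁻¹ * ⟪n, x' - xs⟫_ℝ = a⁻¹ * ⟪d, x' - xs⟫_ℝ := by
    rw [real_inner_smul_left, inner_add_left]; ring
  have h5 : f (a • x' + (1 - a) • xbar) - f xs ≤ (1 - a) * (f xbar - f xs) + a * ⟪d, x' - xs⟫_ℝ
      + (p * (a ^ 2 * ⟪x' - x, L (x' - x)⟫_ℝ) / 2 + q * tr L / 2) := by
    have h6 := mul_le_mul_of_nonneg_left h1 ha0.le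
    have h7 := mul_le_mul_of_nonneg_left h2 (sub_nonneg.2 ha1)
    rw [real_inner_smul_right] at h3
    simp only [inner_sub_right d x'] at h3 ⊢
    linarith
  have h8 := mul_le_mul_of_nonneg_left h5 (sq_nonneg a⁻¹)
  refine h8.trans_eq ?_
  have ha : a⁻¹ * a = 1 := inv_mul_cancel₀ ha0.ne'
  have ha2 : a⁻¹ ^ 2 * a ^ 2 = 1 := by rw [← mul_pow, ha, one_pow]
  have ha3 : a⁻¹ ^ 2 * a = a⁻¹ := by rw [sq, mul_assoc, ha, mul_one]
  linear_combination (p / 2 * ⟪x' - x, L (x' - x)⟫_ℝ) * ha2 + ⟪d, x' - xs⟫_ℝ * ha3 - e3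

/-- Expand `⟨v, S v⟩ ≥ 0` at `v = θ c S⁻¹ n + z` and divide by `2θ`. -/
lemma inner_le_weighted {S : X →L[ℝ] X} (hS : IsPosDef S) {θ : ℝ} (hθ : 0 < θ) (c : ℝ) (n z : X) :
    -(c * ⟪n, z⟫_ℝ) ≤ θ / 2 * (c ^ 2 * wnorm (Ring.inverse S) n ^ 2) + θ⁻¹ / 2 * ⟪z, S z⟫_ℝ := by
  rw [wnorm_sq (isPosDef_inverse hS)]
  set y := Ring.inverse S n with hy
  have hSy : S y = n := by
    rw [hy, ← mul_apply_eq_comp, Ring.mul_inverse_cancel _ hS.isUnit]; rfl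
  have h1 := hS.nonneg ((θ * c) • y + z)
  have h2 : ⟪y, S z⟫_ℝ = ⟪n, z⟫_ℝ := by rw [← inner_apply_of_isSelfAdjoint hS.1, hSy]
  have h3 : ⟪z, n⟫_ℝ = ⟪n, z⟫_ℝ := real_inner_comm _ _
  have h4 : ⟪y, n⟫_ℝ = ⟪n, y⟫_ℝ := real_inner_comm _ _
  simp only [map_add, map_smul, inner_add_left, inner_add_right, real_inner_smul_left,
    real_inner_smul_right, hSy, h2, h3, h4] at h1
  have h5 := mul_nonneg (inv_nonneg.2 hθ.le) h1
  have h6 : θ⁻¹ * θ = 1 := inv_mul_cancel₀ hθ.ne'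
  have h7 : θ⁻¹ * (θ * c * (θ * c * ⟪n, y⟫_ℝ) + θ * c * ⟪n, z⟫_ℝ + (θ * c * ⟪n, z⟫_ℝ + ⟪z, S z⟫_ℝ))
      = θ * c ^ 2 * ⟪n, y⟫_ℝ + 2 * c * ⟪n, z⟫_ℝ + θ⁻¹ * ⟪z, S z⟫_ℝ := by
    field_simp
    ring
  linarith

lemma momentum_pos (k : ℕ) : 0 < momentum k := by unfold momentum; positivity

lemma momentum_le_one (k : ℕ) : momentum k ≤ 1 := by
  unfold momentum
  rw [div_le_one (by positivity)]
  linarith [Nat.cast_nonneg (α := ℝ) k]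

lemma momentum_inv (k : ℕ) : (momentum k)⁻¹ = ((k : ℝ) + 2) / 2 := by
  rw [momentum, inv_div]

/-- The extrapolated points at which the gradients are evaluated. -/
def queryPoint (x xbar : ℕ → X) (k : ℕ) : X := momentum k • x k + (1 - momentum k) • xbar k

section Run

variable {Ξ : Type v} {G : X → Ξ → X} {δ η : ℝ} {K : ℕ} {x₀ : X} {s : ℕ → Ξ} {x xbar g : ℕ → X}
  {H : ℕ → X →L[ℝ] X}

lemma IsAccelRun.precond_eq (hrun : IsAccelRun 𝓗 G δ η momentum K x₀ s x xbar g H)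
    (h : IsPrecondSpace 𝓗) (hδ : 0 < δ) (hη : 0 < η) {k : ℕ} (hk : k ≤ K) :
    H k = η • invSqrtOp (gradAccum 𝓗 δ g (k + 1)) :=
  (hrun.precond k hk).eq_smul_invSqrtOp h hδ hη (isSelfAdjoint_sum_rankOneOp g (k + 1))
    (inner_sum_rankOneOp_nonneg g (k + 1))

lemma IsAccelRun.step_eq (hrun : IsAccelRun 𝓗 G δ η momentum K x₀ s x xbar g H)
    (h : IsPrecondSpace 𝓗) (hδ : 0 < δ) (hη : 0 < η) {k : ℕ} (hk : k ≤ K) :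
    x (k + 1) = x k - η • invSqrtOp (gradAccum 𝓗 δ g (k + 1)) (g k) := by
  rw [(hrun.step k hk).eq_sub (hrun.precond k hk).1.2, hrun.precond_eq h hδ hη hk]
  rfl

/-- The recursion for the objective, summed over the run. -/
lemma IsAccelRun.objective_le_sum (hrun : IsAccelRun 𝓗 G δ η momentum K x₀ s x xbar g H)
    {L : X →L[ℝ] X} {ν : ℝ} {f : X → ℝ} (hf : IsHolderSmooth 𝓗 L ν f) (hν0 : 0 ≤ ν) (hν1 : ν ≤ 1)
    {df : X → X} (hdf : ∀ y, IsSubgradient f y (df y)) {xs : X} (hxs : ∀ y, f xs ≤ f y)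
    {p q : ℝ} (hp : 0 < p) (hq : 0 < q) (hpq : p ^ ((1 + ν) / 2) * q ^ ((1 - ν) / 2) = 1)
    {n : ℕ} (hn : n ≤ K) :
    ((n : ℝ) + 2) ^ 2 / 4 * (f (xbar (n + 1)) - f xs)
      ≤ ∑ k ∈ Finset.range (n + 1), (⟪g k, x (k + 1) - xs⟫_ℝ
        - (momentum k)⁻¹ *
          ⟪G (queryPoint x xbar k) (s k) - df (queryPoint x xbar k), x (k + 1) - xs⟫_ℝ
        + p / 2 * ⟪x (k + 1) - x k, L (x (k + 1) - x k)⟫_ℝ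
        + q / 2 * tr L * ((momentum k)⁻¹) ^ 2) := by
  have hstep : ∀ k ≤ K, ((k : ℝ) + 2) ^ 2 / 4 * (f (xbar (k + 1)) - f xs)
      ≤ (k : ℝ) * (k + 2) / 4 * (f (xbar k) - f xs) + (⟪g k, x (k + 1) - xs⟫_ℝ
        - (momentum k)⁻¹ *
          ⟪G (queryPoint x xbar k) (s k) - df (queryPoint x xbar k), x (k + 1) - xs⟫_ℝ
        + p / 2 * ⟪x (k + 1) - x k, L (x (k + 1) - x k)⟫_ℝ
        + q / 2 * tr L * ((momentum k)⁻¹) ^ 2) := fun k hk => by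
    have h1 := hf.momentum_step hν0 hν1 hp hq hpq (momentum_pos k) (momentum_le_one k)
      (x := x k) (xbar := xbar k) (x' := x (k + 1)) (d := df (queryPoint x xbar k))
      (n := G (queryPoint x xbar k) (s k) - df (queryPoint x xbar k)) xs (hdf _)
    rw [← hrun.average k hk, add_sub_cancel, queryPoint, ← hrun.grad k hk, ← queryPoint] at h1
    have e1 : ((momentum k)⁻¹) ^ 2 = ((k : ℝ) + 2) ^ 2 / 4 := by rw [momentum_inv]; ring
    have e2 : (1 - momentum k) * ((momentum k)⁻¹) ^ 2 = (k : ℝ) * (k + 2) / 4 := by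
      rw [e1, momentum]; field_simp; ring
    rw [e2] at h1
    rw [e1] at h1 ⊢
    linarith
  induction n with
  | zero =>
    -- At `k = 0` the coefficient `k (k + 2) / 4` vanishes, so no initial gap appears.
    have := hstep 0 hn
    simp only [Nat.cast_zero, zero_mul, zero_div, zero_add] at this ⊢
    simpa using this
  | succ n ih =>
    rw [Finset.sum_range_succ]
    have h1 := hstep (n + 1) hn
    have h2 := ih (by omega)
    -- `(n + 1)(n + 3) ≤ (n + 2)²`; minimality of `xs` supplies the sign that makes this usable.
    have h3 : ((n + 1 : ℕ) : ℝ) * (((n + 1 : ℕ) : ℝ) + 2) / 4 * (f (xbar (n + 1)) - f xs)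
        ≤ ((n : ℝ) + 2) ^ 2 / 4 * (f (xbar (n + 1)) - f xs) := by
      refine mul_le_mul_of_nonneg_right ?_ (sub_nonneg.2 (hxs _))
      push_cast; nlinarith
    linarith

/-- The pathwise bound on the suboptimality of a run whose iterates stay bounded. -/
lemma IsAccelRun.objective_le {R : ℝ}
    (hrun : IsAccelRun 𝓗 G δ (2 * R) momentum K x₀ s x xbar g H)
    (h : IsPrecondSpace 𝓗) (hδ : 0 < δ) (hR : 0 < R)
    {L Sig : X →L[ℝ] X} {ν : ℝ} {f : X → ℝ} (hf : IsHolderSmooth 𝓗 L ν f) (hν0 : 0 ≤ ν)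
    (hν1 : ν ≤ 1) {df : X → X} (hdf : ∀ y, IsSubgradient f y (df y))
    (hSm : Sig ∈ 𝓗) (hS : IsPosDef Sig) (hLc : CommutesWith 𝓗 L) (hSc : CommutesWith 𝓗 Sig)
    {xs : X} (hxs : ∀ y, f xs ≤ f y)
    (hdist : ∀ k ≤ K, distNorm 𝓗 (x k - xs) ≤ R)
    {p q θ t₁ t₂ : ℝ} (hp : 0 < p) (hq : 0 < q)
    (hpq : p ^ ((1 + ν) / 2) * q ^ ((1 - ν) / 2) = 1) (hθ : 0 < θ) (ht₁ : 0 < t₁) (ht₂ : 0 < t₂) :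
    ((K : ℝ) + 2) ^ 2 / 4 * (f (xbar (K + 1)) - f xs)
      ≤ R * Real.sqrt δ * Module.finrank ℝ X
        - 3 / 4 * R * tr (sqrtOp (gradAccum 𝓗 δ g (K + 1)))
        - ∑ k ∈ Finset.range (K + 1), (momentum k)⁻¹ *
          ⟪G (queryPoint x xbar k) (s k) - df (queryPoint x xbar k), x k - xs⟫_ℝ
        + θ / 2 * ∑ k ∈ Finset.range (K + 1), ((momentum k)⁻¹) ^ 2 *
          wnorm (Ring.inverse Sig) (G (queryPoint x xbar k) (s k) - df (queryPoint x xbar k)) ^ 2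
        + 4 * θ⁻¹ * R ^ 2 * tr Sig * (Real.log t₂
          + tr (sqrtOp (gradAccum 𝓗 δ g (K + 1))) / (Real.sqrt δ * t₂))
        + 4 * p * R ^ 2 * tr L * (Real.log t₁
          + tr (sqrtOp (gradAccum 𝓗 δ g (K + 1))) / (Real.sqrt δ * t₁))
        + q / 2 * tr L * ∑ k ∈ Finset.range (K + 1), ((momentum k)⁻¹) ^ 2 := by
  have hη : 0 < 2 * R := by linarith
  set N := gradAccum 𝓗 δ g with hN
  set T := tr (sqrtOp (N (K + 1))) with hT
  set ε := fun k => G (queryPoint x xbar k) (s k) - df (queryPoint x xbar k) with hε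
  have hpd : ∀ k, IsPosDef (N k) := fun k => (h.gradAccum_mem_posDefGE hδ g k).1
  have hterm : ∀ k ∈ Finset.range (K + 1), (⟪g k, x (k + 1) - xs⟫_ℝ
        - (momentum k)⁻¹ * ⟪ε k, x (k + 1) - xs⟫_ℝ
        + p / 2 * ⟪x (k + 1) - x k, L (x (k + 1) - x k)⟫_ℝ
        + q / 2 * tr L * ((momentum k)⁻¹) ^ 2)
      ≤ (4 * R)⁻¹ * (⟪x k - xs, sqrtOp (N (k + 1)) (x k - xs)⟫_ℝ
          - ⟪x (k + 1) - xs, sqrtOp (N (k + 1)) (x (k + 1) - xs)⟫_ℝ)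
        - R * ⟪g k, invSqrtOp (N (k + 1)) (g k)⟫_ℝ
        - (momentum k)⁻¹ * ⟪ε k, x k - xs⟫_ℝ
        + θ / 2 * (((momentum k)⁻¹) ^ 2 * wnorm (Ring.inverse Sig) (ε k) ^ 2)
        + 2 * θ⁻¹ * R ^ 2 * ⟪invSqrtOp (N (k + 1)) (g k), Sig (invSqrtOp (N (k + 1)) (g k))⟫_ℝ
        + 2 * p * R ^ 2 * ⟪invSqrtOp (N (k + 1)) (g k), L (invSqrtOp (N (k + 1)) (g k))⟫_ℝ
        + q / 2 * tr L * ((momentum k)⁻¹) ^ 2 := fun k hk => by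
    have hk' : k ≤ K := by rw [Finset.mem_range] at hk; omega
    have hx := hrun.step_eq h hδ hη hk'
    rw [← hN] at hx
    set W := invSqrtOp (N (k + 1)) with hW
    set M := sqrtOp (N (k + 1)) with hM
    set z := W (g k) with hz
    have hMz : M z = g k := by
      rw [hz, ← mul_apply_eq_comp, sqrtOp_mul_invSqrtOp (hpd (k + 1))]; rfl
    have hMsa := (isPosDef_sqrtOp (hpd (k + 1))).1
    set y := x k - xs with hy
    have e0 : x (k + 1) - xs = y - (2 * R) • z := by rw [hx, hy]; abel
    have e1 : x (k + 1) - x k = -((2 * R) • z) := by rw [hx]; abel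
    have e2 : ⟪z, M y⟫_ℝ = ⟪g k, y⟫_ℝ := by rw [← inner_apply_of_isSelfAdjoint hMsa, hMz]
    have e3 : ⟪y, g k⟫_ℝ = ⟪g k, y⟫_ℝ := real_inner_comm _ _
    have e4 : ⟪z, g k⟫_ℝ = ⟪g k, z⟫_ℝ := real_inner_comm _ _
    have h1 := inner_le_weighted hS hθ (momentum k)⁻¹ (ε k) (-((2 * R) • z))
    rw [e1, e0]
    -- Three-point identity for the step `-2R z` in the metric `√N`: since `√N z = g k`, it exhibits
    -- `⟨g k, x (k+1) - xs⟩` as this difference minus `R ⟨g k, z⟩`.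
    have e5 : (4 * R)⁻¹ * (⟪y, M y⟫_ℝ - ⟪y - (2 * R) • z, M (y - (2 * R) • z)⟫_ℝ)
        = ⟪g k, y⟫_ℝ - R * ⟪g k, z⟫_ℝ := by
      simp only [map_sub, map_smul, inner_sub_left, inner_sub_right, real_inner_smul_left,
        real_inner_smul_right, hMz, e2, e3, e4]
      field_simp
      ring
    rw [e5]
    simp only [map_neg, map_smul, inner_neg_left, inner_neg_right, inner_sub_right,
      real_inner_smul_left, real_inner_smul_right] at h1 ⊢
    linarith
  have h1 := hrun.objective_le_sum hf hν0 hν1 hdf hxs hp hq hpq le_rfl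
  have h2 := h1.trans (Finset.sum_le_sum hterm)
  simp only [Finset.sum_add_distrib, Finset.sum_sub_distrib (s := Finset.range (K + 1)),
    ← Finset.mul_sum] at h2
  have hdist' : ∀ k ≤ K, ‖proj 𝓗 (rankOneOp (x k - xs) (x k - xs))‖ ≤ R ^ 2 := fun k hk =>
    (Real.sqrt_le_left hR.le).1 (hdist k hk)
  have h3 := h.sum_inner_sqrtOp_sub_le hδ g (fun k => x k - xs) K hdist'
  have h3' := (isPosDef_sqrtOp (hpd (K + 1))).nonneg (x (K + 1) - xs)
  simp only [Finset.sum_sub_distrib, ← hN] at h3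
  have h4 := h.tr_sqrtOp_le_sum hδ g (K + 1)
  have h5 := h.sum_weighted_le hδ g hSm hS hSc (K + 1) ht₂
  have h6 := h.sum_weighted_le hδ g hf.mem hf.posDef hLc (K + 1) ht₁
  rw [← hN, ← hT] at h4 h5 h6
  rw [← hT] at h3
  have h7 := mul_le_mul_of_nonneg_left (le_trans (le_add_of_nonneg_right h3') h3)
    (show 0 ≤ (4 * R)⁻¹ by positivity)
  -- The distances cost `R T / 4` while the gradient terms return `R T`; this is the source of `-3/4
  -- R T`.
  have e7 : (4 * R)⁻¹ * (R ^ 2 * T) = R * T / 4 := by field_simp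
  have h8 := mul_le_mul_of_nonneg_left h4 hR.le
  have h9 := mul_le_mul_of_nonneg_left h5 (show 0 ≤ 2 * θ⁻¹ * R ^ 2 by positivity)
  have h10 := mul_le_mul_of_nonneg_left h6 (show 0 ≤ 2 * p * R ^ 2 by positivity)
  rw [e7] at h7
  have e9 : 2 * θ⁻¹ * R ^ 2 * (2 * (tr Sig * Real.log t₂ + tr Sig * T / (Real.sqrt δ * t₂)))
      = 4 * θ⁻¹ * R ^ 2 * tr Sig * (Real.log t₂ + T / (Real.sqrt δ * t₂)) := by ring
  have e10 : 2 * p * R ^ 2 * (2 * (tr L * Real.log t₁ + tr L * T / (Real.sqrt δ * t₁)))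
      = 4 * p * R ^ 2 * tr L * (Real.log t₁ + T / (Real.sqrt δ * t₁)) := by ring
  rw [e9] at h9
  rw [e10] at h10
  linarith

end Run

end Pathwise

/-! ### Measurability, independence and moments of the noise -/

noncomputable section Stochastic

variable {X : Type u} [NormedAddCommGroup X] [InnerProductSpace ℝ X] [FiniteDimensional ℝ X]
  [MeasurableSpace X] [BorelSpace X] {𝓗 : Submodule ℝ (X →L[ℝ] X)}

lemma measurable_gradAccum {Ω : Type*} [MeasurableSpace Ω] {δ : ℝ} {g : ℕ → Ω → X} {n : ℕ}
    (hg : ∀ i < n, Measurable (g i)) :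
    Measurable fun ω => gradAccum 𝓗 δ (fun i => g i ω) n := by
  have := FiniteDimensional.proper_real X
  have := FiniteDimensional.proper_real (X →L[ℝ] X)
  have h1 : Measurable fun ω => ∑ i ∈ Finset.range n, rankOneOp (g i ω) (g i ω) := by
    refine Finset.measurable_sum _ fun i hi => ?_
    have h2 : Continuous fun z : X => rankOneOp z z := by
      have e : (fun z : X => rankOneOp z z) = fun z => (innerSL ℝ z).smulRight z := by
        funext z; ext y; simp [rankOneOp_apply]
      rw [e]
      fun_prop
    exact h2.measurable.comp (hg i (Finset.mem_range.1 hi))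
  have h3 : Continuous (proj 𝓗) := LinearMap.continuous_of_finiteDimensional _
  exact (h3.measurable.comp h1).const_add _

/-- The iterates are measurable functions of the samples drawn so far. -/
lemma measurable_iterates {Ω : Type*} [MeasurableSpace Ω] {Ξ : Type v} [MeasurableSpace Ξ]
    {G : X → Ξ → X} (hG : Measurable (Function.uncurry G)) (h : IsPrecondSpace 𝓗) {δ η : ℝ}
    (hδ : 0 < δ) (hη : 0 < η) {K : ℕ} {x₀ : X} {ξ : ℕ → Ω → Ξ} {x xbar g : ℕ → Ω → X}
    {H : ℕ → Ω → X →L[ℝ] X}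
    (hrun : ∀ ω, IsAccelRun 𝓗 G δ η momentum K x₀ (fun k => ξ k ω)
          (fun k => x k ω) (fun k => xbar k ω) (fun k => g k ω) (fun k => H k ω))
    {n : ℕ} (hn : n ≤ K + 1) (hξ : ∀ i < n, Measurable (ξ i)) :
    Measurable (x n) ∧ Measurable (xbar n) ∧ ∀ i < n, Measurable (g i) := by
  have := FiniteDimensional.proper_real X
  have := FiniteDimensional.proper_real (X →L[ℝ] X)
  induction n with
  | zero =>
    refine ⟨?_, ?_, fun i hi => by omega⟩
    · rw [show x 0 = fun _ => x₀ from funext fun ω => (hrun ω).init]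
      exact measurable_const
    · rw [show xbar 0 = fun _ => x₀ from funext fun ω => (hrun ω).init_bar]
      exact measurable_const
  | succ n ih =>
    obtain ⟨hx, hxbar, hg⟩ := ih (by omega) fun i hi => hξ i (by omega)
    have hn' : n ≤ K := by omega
    have hgn : Measurable (g n) := by
      rw [show g n = fun ω => (momentum n)⁻¹ •
        G (momentum n • x n ω + (1 - momentum n) • xbar n ω) (ξ n ω) from
          funext fun ω => (hrun ω).grad n hn']
      exact (hG.comp (((hx.const_smul _).add (hxbar.const_smul _)).prodMk
        (hξ n (by omega)))).const_smul _
    have hg' : ∀ i < n + 1, Measurable (g i) := fun i hi => by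
      rcases Nat.lt_succ_iff_lt_or_eq.1 hi with hi | rfl
      · exact hg i hi
      · exact hgn
    have hx' : Measurable (x (n + 1)) := by
      rw [show x (n + 1) = fun ω => x n ω -
        η • invSqrtOp (gradAccum 𝓗 δ (fun i => g i ω) (n + 1)) (g n ω) from
          funext fun ω => (hrun ω).step_eq h hδ hη hn']
      have h1 : Measurable fun ω => invSqrtOp (gradAccum 𝓗 δ (fun i => g i ω) (n + 1)) :=
        measurable_invSqrtOp hδ (measurable_gradAccum hg')
          fun ω => h.gradAccum_mem_posDefGE hδ (fun i => g i ω) (n + 1)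
      have h2 : Continuous fun P : (X →L[ℝ] X) × X => P.1 P.2 := by fun_prop
      exact hx.sub ((h2.measurable.comp (h1.prodMk hgn)).const_smul _)
    refine ⟨hx', ?_, hg'⟩
    rw [show xbar (n + 1) = fun ω => momentum n • x (n + 1) ω + (1 - momentum n) • xbar n ω from
      funext fun ω => (hrun ω).average n hn']
    exact (hx'.const_smul _).add (hxbar.const_smul _)

lemma indep_iSup_lt {Ω : Type*} {Ξ : Type v} [mΞ : MeasurableSpace Ξ] [mΩ : MeasurableSpace Ω]
    {μ : Measure Ω} {ξ : ℕ → Ω → Ξ} (hξ : ∀ k, Measurable (ξ k)) (hind : iIndepFun ξ μ) (k : ℕ) :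
    Indep (⨆ i ∈ Set.Iio k, mΞ.comap (ξ i)) (mΞ.comap (ξ k)) μ := by
  have h1 := indep_iSup_of_disjoint (S := Set.Iio k) (T := {k}) (fun i => (hξ i).comap_le)
    hind.iIndep (by simp)
  simpa using h1

/-- The current iterate is independent of the current sample. -/
lemma indepFun_iterate {Ω : Type*} [MeasurableSpace Ω] {μ : Measure Ω} {Ξ : Type v}
    [mΞ : MeasurableSpace Ξ]
    {G : X → Ξ → X} (hG : Measurable (Function.uncurry G)) (h : IsPrecondSpace 𝓗) {δ η : ℝ}
    (hδ : 0 < δ) (hη : 0 < η) {K : ℕ} {x₀ : X} {ξ : ℕ → Ω → Ξ} {x xbar g : ℕ → Ω → X}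
    {H : ℕ → Ω → X →L[ℝ] X}
    (hrun : ∀ ω, IsAccelRun 𝓗 G δ η momentum K x₀ (fun k => ξ k ω)
          (fun k => x k ω) (fun k => xbar k ω) (fun k => g k ω) (fun k => H k ω))
    (hξ : ∀ k, Measurable (ξ k)) (hind : iIndepFun ξ μ) {k : ℕ} (hk : k ≤ K) :
    IndepFun (fun ω => (x k ω, xbar k ω)) (ξ k) μ := by
  -- The measurability lemma is applied with the σ-algebra generated by the earlier samples on `Ω`,
  -- so the iterates are adapted.
  have h1 := @measurable_iterates X _ _ _ _ _ 𝓗 Ω (⨆ i ∈ Set.Iio k, mΞ.comap (ξ i)) Ξ _ G hG h δ η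
    hδ hη K x₀ ξ x xbar g H hrun k (by omega) fun i hi =>
      Measurable.of_comap_le (le_iSup₂_of_le i hi le_rfl)
  have h2 : @Measurable Ω (X × X) (⨆ i ∈ Set.Iio k, mΞ.comap (ξ i)) _
      (fun ω => (x k ω, xbar k ω)) := h1.1.prodMk h1.2.1
  rw [IndepFun_iff_Indep]
  exact indep_of_indep_of_le_left (indep_iSup_lt hξ hind k) h2.comap_le

variable {Ξ : Type v} [MeasurableSpace Ξ] {D : Measure Ξ} [IsProbabilityMeasure D]
  {Sig : X →L[ℝ] X} {f : X → ℝ} {df : X → X} {G : X → Ξ → X}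

lemma IsStochGrad.integral_eq (hG : IsStochGrad D 𝓗 Sig f df G) (y : X) :
    ∫ ζ, G y ζ ∂D = df y := by
  have h1 := hG.mean_zero y
  have h2 : Integrable (fun ζ => G y ζ) D := by
    have := (hG.integrable y).add (integrable_const (df y))
    refine this.congr (Filter.Eventually.of_forall fun ζ => ?_)
    simp
  rw [integral_sub h2 (integrable_const _), integral_const] at h1
  simpa [sub_eq_zero] using h1

/-- The subgradient selection is not assumed measurable; it is the parametric integral of the
jointly measurable `G`. -/
lemma IsStochGrad.measurable_df (hG : IsStochGrad D 𝓗 Sig f df G) : Measurable df := by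
  have := FiniteDimensional.proper_real X
  have h1 : StronglyMeasurable fun y => ∫ ζ, G y ζ ∂D :=
    StronglyMeasurable.integral_prod_right hG.measurable.stronglyMeasurable
  rw [show df = fun y => ∫ ζ, G y ζ ∂D from funext fun y => (hG.integral_eq y).symm]
  exact h1.measurable

lemma IsStochGrad.measurable_noise (hG : IsStochGrad D 𝓗 Sig f df G) :
    Measurable fun P : X × Ξ => G P.1 P.2 - df P.1 := by
  have := FiniteDimensional.proper_real X
  exact hG.measurable.sub (hG.measurable_df.comp measurable_fst)

lemma measurable_wnorm_sq (T : X →L[ℝ] X) : Measurable fun z => wnorm T z ^ 2 := by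
  have : Continuous fun z => wnorm T z ^ 2 := by
    unfold wnorm
    fun_prop
  exact this.measurable

variable {Ω : Type w} [MeasurableSpace Ω] {μ : Measure Ω} [IsProbabilityMeasure μ] {ζ : Ω → Ξ}
  {y z : Ω → X}

/-- The noise at a random point independent of the sample has bounded second moment. -/
lemma IsStochGrad.integral_noise_sq_le (hG : IsStochGrad D 𝓗 Sig f df G) (hζ : Measurable ζ)
    (hD : μ.map ζ = D) (hy : Measurable y) (hind : IndepFun y ζ μ) :
    Integrable (fun ω => wnorm (Ring.inverse Sig) (G (y ω) (ζ ω) - df (y ω)) ^ 2) μ ∧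
    ∫ ω, wnorm (Ring.inverse Sig) (G (y ω) (ζ ω) - df (y ω)) ^ 2 ∂μ ≤ trNorm Sig := by
  set F : X × Ξ → ℝ := fun P => wnorm (Ring.inverse Sig) (G P.1 P.2 - df P.1) ^ 2 with hF
  have hFm : Measurable F := (measurable_wnorm_sq _).comp hG.measurable_noise
  have hmap : μ.map (fun ω => (y ω, ζ ω)) = (μ.map y).prod D := by
    rw [← hD]
    exact (indepFun_iff_map_prod_eq_prod_map_map hy.aemeasurable hζ.aemeasurable).1 hind
  have : IsProbabilityMeasure (μ.map y) := Measure.isProbabilityMeasure_map hy.aemeasurable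
  have hinner : Integrable (fun a => ∫ b, F (a, b) ∂D) (μ.map y) := by
    refine Integrable.of_bound
      (hFm.stronglyMeasurable.integral_prod_right (ν := D)).aestronglyMeasurable
      (trNorm Sig) (Filter.Eventually.of_forall fun a => ?_)
    rw [Real.norm_of_nonneg (integral_nonneg fun _ => sq_nonneg _)]
    exact hG.variance_le a
  have hint : Integrable F ((μ.map y).prod D) := by
    refine (integrable_prod_iff hFm.aestronglyMeasurable).2
      ⟨Filter.Eventually.of_forall fun a => hG.sq_integrable a, ?_⟩
    refine hinner.congr (Filter.Eventually.of_forall fun a => ?_)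
    exact integral_congr_ae (Filter.Eventually.of_forall fun b =>
      (Real.norm_of_nonneg (sq_nonneg _)).symm)
  have hpair : Measurable fun ω => (y ω, ζ ω) := hy.prodMk hζ
  refine ⟨?_, ?_⟩
  · rw [← hmap] at hint
    exact hint.comp_measurable hpair
  · calc ∫ ω, wnorm (Ring.inverse Sig) (G (y ω) (ζ ω) - df (y ω)) ^ 2 ∂μ
        = ∫ P, F P ∂(μ.map fun ω => (y ω, ζ ω)) :=
          (integral_map hpair.aemeasurable hFm.aestronglyMeasurable).symm
      _ = ∫ a, ∫ b, F (a, b) ∂D ∂(μ.map y) := by rw [hmap, integral_prod _ hint]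
      _ ≤ ∫ _, trNorm Sig ∂(μ.map y) :=
          integral_mono hinner (integrable_const _) fun a => hG.variance_le a
      _ = trNorm Sig := by simp

/-- The noise is orthogonal in mean to bounded vectors independent of the sample. -/
lemma IsStochGrad.integral_inner_noise (hG : IsStochGrad D 𝓗 Sig f df G) (hζ : Measurable ζ)
    (hD : μ.map ζ = D) (hy : Measurable y) (hz : Measurable z)
    (hind : IndepFun (fun ω => (y ω, z ω)) ζ μ) {B : ℝ} (hB : ∀ᵐ ω ∂μ, ‖z ω‖ ≤ B) :
    Integrable (fun ω => ⟪G (y ω) (ζ ω) - df (y ω), z ω⟫_ℝ) μ ∧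
    ∫ ω, ⟪G (y ω) (ζ ω) - df (y ω), z ω⟫_ℝ ∂μ = 0 := by
  have := FiniteDimensional.proper_real X
  have hyz : Measurable fun ω => (y ω, z ω) := hy.prodMk hz
  have hpair : Measurable fun ω => ((y ω, z ω), ζ ω) := hyz.prodMk hζ
  set F : (X × X) × Ξ → ℝ := fun P => ⟪G P.1.1 P.2 - df P.1.1, P.1.2⟫_ℝ with hF
  have hFm : Measurable F :=
    Measurable.inner (hG.measurable_noise.comp
      ((measurable_fst.comp measurable_fst).prodMk measurable_snd))
      (measurable_snd.comp measurable_fst)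
  have hsq := (hG.integral_noise_sq_le hζ hD hy (hind.comp measurable_fst measurable_id)).1
  -- Young's inequality with both signs `c = ±1` dominates the inner product by the integrable
  -- squared noise plus a constant.
  have hint : Integrable (fun ω => ⟪G (y ω) (ζ ω) - df (y ω), z ω⟫_ℝ) μ := by
    refine Integrable.mono' ((hsq.const_mul (1 / 2)).add (integrable_const (‖Sig‖ * B ^ 2 / 2)))
      (hFm.comp hpair).aestronglyMeasurable ?_
    filter_upwards [hB] with ω hω
    have h1 := inner_le_weighted hG.posDef one_pos 1 (G (y ω) (ζ ω) - df (y ω)) (z ω)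
    have h2 := inner_le_weighted hG.posDef one_pos (-1) (G (y ω) (ζ ω) - df (y ω)) (z ω)
    have h3 : ⟪z ω, Sig (z ω)⟫_ℝ ≤ ‖Sig‖ * B ^ 2 := by
      calc ⟪z ω, Sig (z ω)⟫_ℝ ≤ ‖z ω‖ * (‖Sig‖ * ‖z ω‖) :=
            (real_inner_le_norm _ _).trans
              (mul_le_mul_of_nonneg_left (Sig.le_opNorm _) (norm_nonneg _))
        _ = ‖Sig‖ * ‖z ω‖ ^ 2 := by ring
        _ ≤ ‖Sig‖ * B ^ 2 := by gcongr
    rw [Pi.add_apply, Real.norm_eq_abs, abs_le]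
    constructor <;> linarith
  refine ⟨hint, ?_⟩
  have hmap : μ.map (fun ω => ((y ω, z ω), ζ ω)) = (μ.map fun ω => (y ω, z ω)).prod D := by
    rw [← hD]
    exact (indepFun_iff_map_prod_eq_prod_map_map hyz.aemeasurable hζ.aemeasurable).1 hind
  have : IsProbabilityMeasure (μ.map fun ω => (y ω, z ω)) :=
    Measure.isProbabilityMeasure_map hyz.aemeasurable
  have hintF : Integrable F ((μ.map fun ω => (y ω, z ω)).prod D) := by
    rw [← hmap]
    exact (integrable_map_measure hFm.aestronglyMeasurable hpair.aemeasurable).2 hint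
  calc ∫ ω, ⟪G (y ω) (ζ ω) - df (y ω), z ω⟫_ℝ ∂μ
      = ∫ P, F P ∂(μ.map fun ω => ((y ω, z ω), ζ ω)) :=
        (integral_map hpair.aemeasurable hFm.aestronglyMeasurable).symm
    _ = ∫ a, ∫ b, F (a, b) ∂D ∂(μ.map fun ω => (y ω, z ω)) := by
        rw [hmap, integral_prod _ hintF]
    _ = 0 := by
        have h0 : ∀ a : X × X, ∫ b, F (a, b) ∂D = 0 := fun a => by
          have h1 : ∀ b, F (a, b) = ⟪a.2, G a.1 b - df a.1⟫_ℝ := fun b => real_inner_comm _ _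
          simp_rw [h1]
          rw [integral_inner (hG.integrable a.1), hG.mean_zero, inner_zero_right]
        simp [h0]

end Stochastic

/-! ### Choice of parameters and the expected rate -/

section Rate

/-- The value of `t` makes the coefficient of `T` at most `3/8 R`, half of the budget `3/4 R T`: the
smoothness and noise terms each use one half. -/
lemma four_mul_log_add_le {a T R δ : ℝ} (hT : 0 ≤ T) (hR : 0 < R) (hδ : 0 < δ) :
    4 * a * (Real.log (max 1 (32 / 3 * (a / (R * Real.sqrt δ))))
        + T / (Real.sqrt δ * max 1 (32 / 3 * (a / (R * Real.sqrt δ)))))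
      ≤ 4 * a * Real.log (max 1 (32 / 3 * (a / (R * Real.sqrt δ)))) + 3 / 8 * R * T := by
  have hs := Real.sqrt_pos.2 hδ
  set t := max 1 (32 / 3 * (a / (R * Real.sqrt δ))) with ht
  have ht0 : 0 < t := lt_of_lt_of_le one_pos (le_max_left _ _)
  have h1 : 32 / 3 * (a / (R * Real.sqrt δ)) ≤ t := le_max_right _ _
  rw [← mul_div_assoc, div_le_iff₀ (by positivity)] at h1
  have h2 : 4 * a * (T / (Real.sqrt δ * t)) ≤ 3 / 8 * R * T := by
    rw [← mul_div_assoc, div_le_iff₀ (by positivity)]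
    have := mul_le_mul_of_nonneg_right h1 hT
    linarith
  linarith

/-- `K + 2 ≤ 3 K` turns `ln (K + 2)` into `ln 3 + ln K`. The `6` collects `ln (32/3) ≤ 3` and `3/2
ln 3 ≤ 3`. -/
lemma log_max_one_le {K : ℕ} (hK : 1 ≤ K) {m b : ℝ} (hm : 0 ≤ m) (hb1 : 1 ≤ b)
    (hb : Real.log b ≤ 3 / 2 * Real.log ((K : ℝ) + 2)) :
    Real.log (max 1 (32 / 3 * (m * b))) ≤ 6 + 3 / 2 * Real.log K + max 0 (Real.log m) := by
  have hK' : (1 : ℝ) ≤ K := by exact_mod_cast hK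
  have h1 : max 1 (32 / 3 * (m * b)) ≤ 32 / 3 * (max 1 m * b) := by
    refine max_le ?_ ?_
    · nlinarith [le_max_left 1 m, mul_le_mul (le_max_left 1 m) hb1 zero_le_one (by positivity)]
    · gcongr
      exact le_max_right _ _
  have hm1 : (0 : ℝ) < max 1 m := lt_of_lt_of_le one_pos (le_max_left _ _)
  have h2 := Real.log_le_log (lt_of_lt_of_le one_pos (le_max_left _ _)) h1
  rw [Real.log_mul (by norm_num) (by positivity), Real.log_mul hm1.ne' (by positivity)] at h2
  have h3 : Real.log (max 1 m) = max 0 (Real.log m) := by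
    rw [← Real.posLog_eq_log_max_one hm]; rfl
  have h4 : Real.log ((K : ℝ) + 2) ≤ Real.log 3 + Real.log K := by
    rw [← Real.log_mul (by norm_num) (by positivity)]
    exact Real.log_le_log (by positivity) (by linarith)
  have he := Real.exp_one_gt_d9
  have hlog : ∀ {r : ℝ} (n : ℕ), 0 < r → r ≤ 2.7 ^ n → Real.log r ≤ n := fun n hr hrn => by
    rw [Real.log_le_iff_le_exp hr, ← Real.exp_one_pow]
    exact hrn.trans (pow_le_pow_left₀ (by norm_num) (by linarith) n)
  have h5 : Real.log 3 ≤ 2 := hlog 2 (by norm_num) (by norm_num)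
  have h6 : Real.log (32 / 3) ≤ 3 := hlog 3 (by norm_num) (by norm_num)
  rw [h3] at h2
  linarith

lemma sum_momentum_inv_sq_le (K : ℕ) :
    ∑ k ∈ Finset.range (K + 1), ((momentum k)⁻¹) ^ 2 ≤ ((K : ℝ) + 2) ^ 3 := by
  have h1 : ∀ k ∈ Finset.range (K + 1), ((momentum k)⁻¹) ^ 2 ≤ ((K : ℝ) + 2) ^ 2 := fun k hk => by
    have hk' : (k : ℝ) ≤ K := by exact_mod_cast Nat.lt_succ_iff.1 (Finset.mem_range.1 hk)
    rw [momentum_inv]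
    refine pow_le_pow_left₀ (by positivity) ?_ 2
    linarith [Nat.cast_nonneg (α := ℝ) k]
  refine (Finset.sum_le_card_nsmul _ _ _ h1).trans ?_
  rw [Finset.card_range, nsmul_eq_mul]
  push_cast
  nlinarith [sq_nonneg ((K : ℝ) + 2)]

variable {X : Type u} [NormedAddCommGroup X] [InnerProductSpace ℝ X] [FiniteDimensional ℝ X]
  {𝓗 : Submodule ℝ (X →L[ℝ] X)}

/-- The pathwise bound with all parameters chosen. -/
lemma IsAccelRun.objective_le_of_distNorm_le {Ξ : Type v} {G : X → Ξ → X} {δ R : ℝ} {K : ℕ}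
    {x₀ : X} {s : ℕ → Ξ} {x xbar g : ℕ → X} {H : ℕ → X →L[ℝ] X}
    (hrun : IsAccelRun 𝓗 G δ (2 * R) momentum K x₀ s x xbar g H)
    (h : IsPrecondSpace 𝓗) (hδ : 0 < δ) (hR : 0 < R) (hK : 1 ≤ K)
    {L Sig : X →L[ℝ] X} {ν : ℝ} {f : X → ℝ} (hf : IsHolderSmooth 𝓗 L ν f) (hν0 : 0 ≤ ν)
    (hν1 : ν ≤ 1) {df : X → X} (hdf : ∀ y, IsSubgradient f y (df y))
    (hSm : Sig ∈ 𝓗) (hS : IsPosDef Sig) (hLc : CommutesWith 𝓗 L) (hSc : CommutesWith 𝓗 Sig)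
    {xs : X} (hxs : ∀ y, f xs ≤ f y)
    (hdist : ∀ k ≤ K, distNorm 𝓗 (x k - xs) ≤ R) :
    ((K : ℝ) + 2) ^ 2 / 4 * (f (xbar (K + 1)) - f xs)
      ≤ R * Real.sqrt δ * Module.finrank ℝ X
        - ∑ k ∈ Finset.range (K + 1), (momentum k)⁻¹ *
          ⟪G (queryPoint x xbar k) (s k) - df (queryPoint x xbar k), x k - xs⟫_ℝ
        + R * ((K : ℝ) + 2) ^ (-(3 / 2) : ℝ) / 2 *
          ∑ k ∈ Finset.range (K + 1), ((momentum k)⁻¹) ^ 2 *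
          wnorm (Ring.inverse Sig) (G (queryPoint x xbar k) (s k) - df (queryPoint x xbar k)) ^ 2
        + R * ((K : ℝ) + 2) ^ (3 / 2 : ℝ) * tr Sig
          * (4 * (6 + 3 / 2 * Real.log K + max 0 (Real.log (tr Sig / Real.sqrt δ))))
        + R ^ (1 + ν) * ((K : ℝ) + 2) ^ (3 * (1 - ν) / 2) * tr L
          * (1 / 2 + 4 * (6 + 3 / 2 * Real.log K
            + max 0 (Real.log (tr L * R ^ ν / Real.sqrt δ)))) := by
  set κ : ℝ := (K : ℝ) + 2 with hκ
  have hκ1 : 1 ≤ κ := by rw [hκ]; linarith [Nat.cast_nonneg (α := ℝ) K]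
  have hκ0 : 0 < κ := by linarith
  have hs := Real.sqrt_pos.2 hδ
  have hτ := tr_nonneg hf.posDef.nonneg
  have hσ := tr_nonneg hS.nonneg
  set P := R ^ (1 + ν) * κ ^ (3 * (1 - ν) / 2) with hP
  set Q := R * κ ^ (3 / 2 : ℝ) with hQ
  have hP0 : 0 < P := by positivity
  have hQ0 : 0 < Q := by positivity
  -- The weights balance their two costs: `p R² = q κ³ = P` and `θ⁻¹ R² = θ κ³ = Q`, where `κ³`
  -- bounds the sum of `α_k⁻²`.
  set p := R ^ (ν - 1) * κ ^ (3 * (1 - ν) / 2) with hp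
  set q := R ^ (1 + ν) * κ ^ (-(3 * (1 + ν) / 2)) with hq
  set θ := R * κ ^ (-(3 / 2) : ℝ) with hθ
  have hpq : p ^ ((1 + ν) / 2) * q ^ ((1 - ν) / 2) = 1 := by
    rw [hp, hq, Real.mul_rpow (by positivity) (by positivity),
      Real.mul_rpow (by positivity) (by positivity), ← Real.rpow_mul hR.le, ← Real.rpow_mul hR.le,
      ← Real.rpow_mul hκ0.le, ← Real.rpow_mul hκ0.le, mul_mul_mul_comm, ← Real.rpow_add hR,
      ← Real.rpow_add hκ0]
    rw [show (ν - 1) * ((1 + ν) / 2) + (1 + ν) * ((1 - ν) / 2) = 0 by ring,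
      show 3 * (1 - ν) / 2 * ((1 + ν) / 2) + -(3 * (1 + ν) / 2) * ((1 - ν) / 2) = 0 by ring,
      Real.rpow_zero, Real.rpow_zero, one_mul]
  have hpR : p * R ^ 2 = P := by
    rw [hp, hP, mul_right_comm, ← Real.rpow_natCast R 2, ← Real.rpow_add hR]
    congr 2; push_cast; ring
  have hqκ : q * κ ^ 3 = P := by
    rw [hq, hP, mul_assoc, ← Real.rpow_natCast κ 3, ← Real.rpow_add hκ0]
    congr 2; push_cast; ring
  have hθR : θ⁻¹ * R ^ 2 = Q := by
    rw [hθ, hQ, mul_inv, ← Real.rpow_neg hκ0.le, neg_neg]; field_simp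
  set t₁ := max 1 (32 / 3 * ((P * tr L) / (R * Real.sqrt δ))) with ht₁
  set t₂ := max 1 (32 / 3 * ((Q * tr Sig) / (R * Real.sqrt δ))) with ht₂
  have hmain := hrun.objective_le h hδ hR hf hν0 hν1 hdf hSm hS hLc hSc hxs hdist
    (p := p) (q := q) (θ := θ) (t₁ := t₁) (t₂ := t₂) (by positivity) (by positivity) hpq
    (by positivity) (lt_of_lt_of_le one_pos (le_max_left _ _))
    (lt_of_lt_of_le one_pos (le_max_left _ _))
  set T := tr (sqrtOp (gradAccum 𝓗 δ g (K + 1))) with hT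
  have hT0 : 0 ≤ T := tr_nonneg (isPosDef_sqrtOp (h.gradAccum_mem_posDefGE hδ g (K + 1)).1).nonneg
  have a1 := four_mul_log_add_le (a := P * tr L) hT0 hR hδ
  have a2 := four_mul_log_add_le (a := Q * tr Sig) hT0 hR hδ
  rw [← ht₁] at a1
  rw [← ht₂] at a2
  have hlogκ : 0 ≤ Real.log κ := Real.log_nonneg hκ1
  have b1 : Real.log t₁ ≤ 6 + 3 / 2 * Real.log K + max 0 (Real.log (tr L * R ^ ν / Real.sqrt δ)) := by
    have e : (P * tr L) / (R * Real.sqrt δ)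
        = (tr L * R ^ ν / Real.sqrt δ) * κ ^ (3 * (1 - ν) / 2) := by
      rw [hP, Real.rpow_add hR, Real.rpow_one]; field_simp
    rw [ht₁, e]
    refine log_max_one_le hK (by positivity) (Real.one_le_rpow hκ1 (by linarith)) ?_
    rw [Real.log_rpow hκ0]
    exact mul_le_mul_of_nonneg_right (by linarith) hlogκ
  have b2 : Real.log t₂ ≤ 6 + 3 / 2 * Real.log K + max 0 (Real.log (tr Sig / Real.sqrt δ)) := by
    have e : (Q * tr Sig) / (R * Real.sqrt δ) = (tr Sig / Real.sqrt δ) * κ ^ (3 / 2 : ℝ) := by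
      rw [hQ]; field_simp
    rw [ht₂, e]
    refine log_max_one_le hK (by positivity) (Real.one_le_rpow hκ1 (by norm_num)) ?_
    rw [Real.log_rpow hκ0]
  have c1 := mul_le_mul_of_nonneg_left b1 (show 0 ≤ 4 * (P * tr L) by positivity)
  have c2 := mul_le_mul_of_nonneg_left b2 (show 0 ≤ 4 * (Q * tr Sig) by positivity)
  have d1 : q / 2 * tr L * ∑ k ∈ Finset.range (K + 1), ((momentum k)⁻¹) ^ 2 ≤ P * tr L / 2 := by
    refine (mul_le_mul_of_nonneg_left (sum_momentum_inv_sq_le K) (by positivity)).trans_eq ?_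
    rw [← hκ, ← hqκ]; ring
  have e1 : 4 * p * R ^ 2 * tr L = 4 * (P * tr L) := by rw [← hpR]; ring
  have e2 : 4 * θ⁻¹ * R ^ 2 * tr Sig = 4 * (Q * tr Sig) := by rw [← hθR]; ring
  rw [e1, e2] at hmain
  linarith

/-- The case `D = I` of `inner_le_mul_tr`. It provides the uniform bound that makes the noise inner
products integrable. -/
lemma IsPrecondSpace.norm_le_of_distNorm_le (h : IsPrecondSpace 𝓗) {R : ℝ} (hR : 0 ≤ R) {x : X}
    (hx : distNorm 𝓗 x ≤ R) : ‖x‖ ≤ R * Real.sqrt (Module.finrank ℝ X) := by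
  have h1 := h.inner_le_mul_tr h.one_mem isPosDef_one.nonneg
    ((Real.sqrt_le_left hR).1 hx)
  rw [tr_one, one_apply_eq_self, real_inner_self_eq_norm_sq] at h1
  refine abs_le_of_sq_le_sq' ?_ (by positivity) |>.2
  rwa [mul_pow, Real.sq_sqrt (Nat.cast_nonneg _)]

lemma IsDiagonalSpace.commutesWith {ι : Type v} [Fintype ι] {b : OrthonormalBasis ι ℝ X}
    (hb : IsDiagonalSpace b 𝓗) {T : X →L[ℝ] X} (hT : T ∈ 𝓗) : CommutesWith 𝓗 T := fun S hS => by
  refine ext_orthonormalBasis b fun i => ?_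
  obtain ⟨c, hc⟩ := hb T hT i
  obtain ⟨d, hd⟩ := hb S hS i
  rw [mul_apply_eq_comp, mul_apply_eq_comp, hc, hd, map_smul, map_smul, hc, hd, smul_smul,
    smul_smul, mul_comm]

/-- The expected suboptimality of the averaged iterate. -/
lemma integral_objective_le [MeasurableSpace X] [BorelSpace X] {Ξ : Type v} [MeasurableSpace Ξ]
    {D : Measure Ξ} {df : X → X} {G : X → Ξ → X} {Ω : Type w} [MeasurableSpace Ω] {μ : Measure Ω}
    [IsProbabilityMeasure μ] {ξ : ℕ → Ω → Ξ} {K : ℕ} {x₀ : X} {x xbar g : ℕ → Ω → X}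
    {H : ℕ → Ω → X →L[ℝ] X} {L Sig : X →L[ℝ] X} {ν δ R : ℝ} {f : X → ℝ} {xs : X}
    (hν0 : 0 ≤ ν) (hν1 : ν ≤ 1) (hδ : 0 < δ) (hR : 0 < R) (hK : 1 ≤ K)
    (hxs : ∀ y, f xs ≤ f y) (h : IsPrecondSpace 𝓗) (hf : IsHolderSmooth 𝓗 L ν f)
    (hG : IsStochGrad D 𝓗 Sig f df G) (hLc : CommutesWith 𝓗 L) (hSc : CommutesWith 𝓗 Sig)
    (hξ : ∀ k, Measurable (ξ k)) (hind : iIndepFun ξ μ) (hD : ∀ k, μ.map (ξ k) = D)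
    (hrun : ∀ ω, IsAccelRun 𝓗 G δ (2 * R) momentum K x₀ (fun k => ξ k ω)
      (fun k => x k ω) (fun k => xbar k ω) (fun k => g k ω) (fun k => H k ω))
    (hdist : ∀ᵐ ω ∂μ, ∀ k ≤ K, distNorm 𝓗 (x k ω - xs) ≤ R) :
    Integrable (fun ω => f (xbar (K + 1) ω) - f xs) μ ∧
    ((K : ℝ) + 2) ^ 2 / 4 * ∫ ω, (f (xbar (K + 1) ω) - f xs) ∂μ
      ≤ R * Real.sqrt δ * Module.finrank ℝ X
        + R * ((K : ℝ) + 2) ^ (3 / 2 : ℝ) * tr Sig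
          * (1 / 2 + 4 * (6 + 3 / 2 * Real.log K + max 0 (Real.log (tr Sig / Real.sqrt δ))))
        + R ^ (1 + ν) * ((K : ℝ) + 2) ^ (3 * (1 - ν) / 2) * tr L
          * (1 / 2 + 4 * (6 + 3 / 2 * Real.log K
            + max 0 (Real.log (tr L * R ^ ν / Real.sqrt δ)))) := by
  have hη : 0 < 2 * R := by linarith
  have : IsProbabilityMeasure D := by
    rw [← hD 0]; exact Measure.isProbabilityMeasure_map (hξ 0).aemeasurable
  have := FiniteDimensional.proper_real X
  set κ : ℝ := (K : ℝ) + 2 with hκ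
  have hκ0 : 0 < κ := by rw [hκ]; positivity
  set A := R * Real.sqrt δ * Module.finrank ℝ X with hA
  set A₁ := R * κ ^ (3 / 2 : ℝ) * tr Sig
    * (4 * (6 + 3 / 2 * Real.log K + max 0 (Real.log (tr Sig / Real.sqrt δ)))) with hA₁
  set A₂ := R ^ (1 + ν) * κ ^ (3 * (1 - ν) / 2) * tr L * (1 / 2 + 4 * (6 + 3 / 2 * Real.log K
    + max 0 (Real.log (tr L * R ^ ν / Real.sqrt δ)))) with hA₂
  set y : ℕ → Ω → X := fun k ω => queryPoint (fun k => x k ω) (fun k => xbar k ω) k with hy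
  set ε : ℕ → Ω → X := fun k ω => G (y k ω) (ξ k ω) - df (y k ω) with hε
  have hmeas : ∀ {n}, n ≤ K + 1 → Measurable (x n) ∧ Measurable (xbar n) := fun hn =>
    have := measurable_iterates hG.measurable h hδ hη hrun hn fun i _ => hξ i
    ⟨this.1, this.2.1⟩
  have hquery : ∀ k, Measurable fun P : X × X => momentum k • P.1 + (1 - momentum k) • P.2 :=
    fun k => (measurable_fst.const_smul _).add (measurable_snd.const_smul _)
  have hym : ∀ k ≤ K, Measurable (y k) := fun k hk =>
    (hquery k).comp ((hmeas (by omega)).1.prodMk (hmeas (by omega)).2)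
  have hzm : ∀ k ≤ K, Measurable fun ω => x k ω - xs := fun k hk => (hmeas (by omega)).1.sub_const _
  have hindep : ∀ k ≤ K, IndepFun (fun ω => (y k ω, x k ω - xs)) (ξ k) μ := fun k hk =>
    (indepFun_iterate hG.measurable h hδ hη hrun hξ hind hk).comp
      (φ := fun P : X × X => (momentum k • P.1 + (1 - momentum k) • P.2, P.1 - xs))
      (ψ := id) ((hquery k).prodMk (measurable_fst.sub_const _)) measurable_id
  have hmart : ∀ k ∈ Finset.range (K + 1), Integrable (fun ω => ⟪ε k ω, x k ω - xs⟫_ℝ) μ ∧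
      ∫ ω, ⟪ε k ω, x k ω - xs⟫_ℝ ∂μ = 0 := fun k hk => by
    have hk' : k ≤ K := Nat.lt_succ_iff.1 (Finset.mem_range.1 hk)
    refine hG.integral_inner_noise (hξ k) (hD k) (hym k hk') (hzm k hk') (hindep k hk')
      (B := R * Real.sqrt (Module.finrank ℝ X)) ?_
    filter_upwards [hdist] with ω hω
    exact h.norm_le_of_distNorm_le hR.le (hω k hk')
  have hsq : ∀ k ∈ Finset.range (K + 1),
      Integrable (fun ω => wnorm (Ring.inverse Sig) (ε k ω) ^ 2) μ ∧
      ∫ ω, wnorm (Ring.inverse Sig) (ε k ω) ^ 2 ∂μ ≤ tr Sig := fun k hk => by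
    have hk' : k ≤ K := Nat.lt_succ_iff.1 (Finset.mem_range.1 hk)
    rw [← trNorm_eq_tr hG.posDef]
    exact hG.integral_noise_sq_le (hξ k) (hD k) (hym k hk')
      ((hindep k hk').comp measurable_fst measurable_id)
  set U : Ω → ℝ := fun ω => A - ∑ k ∈ Finset.range (K + 1), (momentum k)⁻¹ * ⟪ε k ω, x k ω - xs⟫_ℝ
    + R * κ ^ (-(3 / 2) : ℝ) / 2 * (∑ k ∈ Finset.range (K + 1), ((momentum k)⁻¹) ^ 2 *
      wnorm (Ring.inverse Sig) (ε k ω) ^ 2) + A₁ + A₂ with hU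
  have hle : ∀ᵐ ω ∂μ, κ ^ 2 / 4 * (f (xbar (K + 1) ω) - f xs) ≤ U ω := by
    filter_upwards [hdist] with ω hω
    exact (hrun ω).objective_le_of_distNorm_le h hδ hR hK hf hν0 hν1 hG.subgradient hG.mem
      hG.posDef hLc hSc hxs hω
  have i1 : Integrable (fun ω => ∑ k ∈ Finset.range (K + 1),
      (momentum k)⁻¹ * ⟪ε k ω, x k ω - xs⟫_ℝ) μ :=
    integrable_finsetSum _ fun k hk => (hmart k hk).1.const_mul _
  have i2 : Integrable (fun ω => ∑ k ∈ Finset.range (K + 1), ((momentum k)⁻¹) ^ 2 *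
      wnorm (Ring.inverse Sig) (ε k ω) ^ 2) μ :=
    integrable_finsetSum _ fun k hk => (hsq k hk).1.const_mul _
  have i3 : Integrable (fun ω => A - ∑ k ∈ Finset.range (K + 1),
      (momentum k)⁻¹ * ⟪ε k ω, x k ω - xs⟫_ℝ) μ := (integrable_const A).sub i1
  have i4 : Integrable (fun ω => R * κ ^ (-(3 / 2) : ℝ) / 2 * (∑ k ∈ Finset.range (K + 1),
      ((momentum k)⁻¹) ^ 2 * wnorm (Ring.inverse Sig) (ε k ω) ^ 2)) μ := i2.const_mul _
  have i34 : Integrable (fun ω => A - ∑ k ∈ Finset.range (K + 1),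
      (momentum k)⁻¹ * ⟪ε k ω, x k ω - xs⟫_ℝ + R * κ ^ (-(3 / 2) : ℝ) / 2 *
      (∑ k ∈ Finset.range (K + 1), ((momentum k)⁻¹) ^ 2 *
      wnorm (Ring.inverse Sig) (ε k ω) ^ 2)) μ := i3.add i4
  have i5 : Integrable (fun ω => A - ∑ k ∈ Finset.range (K + 1),
      (momentum k)⁻¹ * ⟪ε k ω, x k ω - xs⟫_ℝ + R * κ ^ (-(3 / 2) : ℝ) / 2 *
      (∑ k ∈ Finset.range (K + 1), ((momentum k)⁻¹) ^ 2 *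
      wnorm (Ring.inverse Sig) (ε k ω) ^ 2) + A₁) μ :=
    i34.add (integrable_const A₁)
  have hUint : Integrable U μ := i5.add (integrable_const A₂)
  have hfc : Continuous f := hf.convex.locallyLipschitz.continuous
  -- The gap is measurable and lies almost surely between `0` and a multiple of the integrable
  -- pathwise bound.
  have hint : Integrable (fun ω => f (xbar (K + 1) ω) - f xs) μ := by
    refine Integrable.mono' (hUint.const_mul (4 / κ ^ 2))
      ((hfc.measurable.comp (hmeas le_rfl).2).sub_const _).aestronglyMeasurable ?_
    filter_upwards [hle] with ω hω
    rw [Real.norm_of_nonneg (sub_nonneg.2 (hxs _)), div_mul_eq_mul_div, le_div_iff₀ (by positivity)]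
    linarith
  refine ⟨hint, ?_⟩
  have hUval : ∫ ω, U ω ∂μ = A - 0 + R * κ ^ (-(3 / 2) : ℝ) / 2 * (∑ k ∈ Finset.range (K + 1),
      ((momentum k)⁻¹) ^ 2 * ∫ ω, wnorm (Ring.inverse Sig) (ε k ω) ^ 2 ∂μ) + A₁ + A₂ := by
    simp only [hU]
    rw [integral_add i5 (integrable_const _), integral_add i34 (integrable_const _),
      integral_add i3 i4, integral_sub (integrable_const _) i1,
      integral_const_mul (R * κ ^ (-(3 / 2) : ℝ) / 2),
      integral_finsetSum _ fun k hk => (hmart k hk).1.const_mul _,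
      integral_finsetSum _ fun k hk => (hsq k hk).1.const_mul _]
    simp only [integral_const_mul, integral_const, probReal_univ, one_smul]
    rw [Finset.sum_eq_zero fun k hk => by rw [(hmart k hk).2, mul_zero]]
  have hnoise : ∑ k ∈ Finset.range (K + 1),
      ((momentum k)⁻¹) ^ 2 * ∫ ω, wnorm (Ring.inverse Sig) (ε k ω) ^ 2 ∂μ ≤ κ ^ 3 * tr Sig := by
    calc _ ≤ ∑ k ∈ Finset.range (K + 1), ((momentum k)⁻¹) ^ 2 * tr Sig :=
          Finset.sum_le_sum fun k hk => mul_le_mul_of_nonneg_left (hsq k hk).2 (sq_nonneg _)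
      _ ≤ _ := by
          rw [← Finset.sum_mul]
          exact mul_le_mul_of_nonneg_right (sum_momentum_inv_sq_le K)
            (tr_nonneg hG.posDef.nonneg)
  have hκpow : κ ^ (-(3 / 2) : ℝ) * κ ^ 3 = κ ^ (3 / 2 : ℝ) := by
    rw [← Real.rpow_natCast κ 3, ← Real.rpow_add hκ0]
    norm_num
  have h1 := integral_mono_ae (hint.const_mul (κ ^ 2 / 4)) hUint hle
  rw [integral_const_mul, hUval] at h1
  have h2 := mul_le_mul_of_nonneg_left hnoise (show 0 ≤ R * κ ^ (-(3 / 2) : ℝ) / 2 by positivity)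
  have h3 : R * κ ^ (-(3 / 2) : ℝ) / 2 * (κ ^ 3 * tr Sig) = R * κ ^ (3 / 2 : ℝ) * tr Sig / 2 := by
    rw [← hκpow]; ring
  rw [h3] at h2
  rw [hA₁] at h1
  linarith

end Rate

end AccelPrecond

theorem mainTheorem2 :
    -- the convergence rate; `c` is the absolute constant of the `O(·)`
    (∃ c : ℝ, 0 < c ∧
      ∀ (X : Type u) [NormedAddCommGroup X] [InnerProductSpace ℝ X] [FiniteDimensional ℝ X]
        [MeasurableSpace X] [BorelSpace X]
        (𝓗 : Submodule ℝ (X →L[ℝ] X)) (L Sig : X →L[ℝ] X) (ν δ R : ℝ)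
        (f : X → ℝ) (xstar : X)
        (Ξ : Type v) [MeasurableSpace Ξ] (D : Measure Ξ) (df : X → X) (G : X → Ξ → X)
        (Ω : Type w) [MeasurableSpace Ω] (μ : Measure Ω) [IsProbabilityMeasure μ]
        (ξ : ℕ → Ω → Ξ) (K : ℕ) (x₀ : X)
        (x xbar g : ℕ → Ω → X) (H : ℕ → Ω → X →L[ℝ] X),
        0 ≤ ν → ν ≤ 1 → 0 < δ → 0 < R → 1 ≤ K →
        (∀ y, f xstar ≤ f y) →
        IsPrecondSpace 𝓗 →
        IsHolderSmooth 𝓗 L ν f →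
        IsStochGrad D 𝓗 Sig f df G →
        CommutesWith 𝓗 L → CommutesWith 𝓗 Sig →
        (∀ k, Measurable (ξ k)) → iIndepFun ξ μ → (∀ k, μ.map (ξ k) = D) →
        (∀ ω, IsAccelRun 𝓗 G δ (2 * R) momentum K x₀ (fun k => ξ k ω)
          (fun k => x k ω) (fun k => xbar k ω) (fun k => g k ω) (fun k => H k ω)) →
        (∀ᵐ ω ∂μ, ∀ k ≤ K, distNorm 𝓗 (x k ω - xstar) ≤ R) →
        ∃ C : ℝ, 0 < C ∧
          C ≤ c * (1 + Real.log K + max 0 (Real.log (trNorm L * R ^ ν / Real.sqrt δ))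
            + max 0 (Real.log (trNorm Sig / Real.sqrt δ))) ∧
          Integrable (fun ω => f (xbar (K + 1) ω) - f xstar) μ ∧
          ∫ ω, (f (xbar (K + 1) ω) - f xstar) ∂μ
            ≤ C * trNorm L * R ^ (1 + ν) / ((K : ℝ) + 2) ^ ((1 + 3 * ν) / 2)
              + C * trNorm Sig * R / Real.sqrt ((K : ℝ) + 2)
              + 4 * Real.sqrt δ * R * (Module.finrank ℝ X : ℝ) / ((K : ℝ) + 2) ^ 2) ∧
    -- for diagonal preconditioners the commutation assumption holds automatically
    (∀ (X : Type u) [NormedAddCommGroup X] [InnerProductSpace ℝ X] [FiniteDimensional ℝ X]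
      (ι : Type v) [Fintype ι] (b : OrthonormalBasis ι ℝ X) (𝓗 : Submodule ℝ (X →L[ℝ] X)),
      IsDiagonalSpace b 𝓗 → ∀ T ∈ 𝓗, CommutesWith 𝓗 T) := by
  -- After multiplication by `κ² / 4` the brackets `1/2 + 24 + 6 ln K + 4 ℓ` must be at most `C /
  -- 4`, and `25 (1 + ln K + ℓ₁ + ℓ₂)` suffices.
  refine ⟨⟨100, by norm_num, ?_⟩, fun X _ _ _ ι _ b 𝓗 hb T hT => hb.commutesWith hT⟩
  intro X _ _ _ _ _ 𝓗 L Sig ν δ R f xstar Ξ _ D df G Ω _ μ _ ξ K x₀ x xbar g H hν0 hν1 hδ hR hK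
    hmin h𝓗 hf hG hLc hSc hξ hind hD hrun hdist
  obtain ⟨hint, hle⟩ := integral_objective_le hν0 hν1 hδ hR hK hmin h𝓗 hf hG hLc hSc hξ hind hD
    hrun hdist
  rw [trNorm_eq_tr hf.posDef, trNorm_eq_tr hG.posDef]
  have hκ0 : 0 < (K : ℝ) + 2 := by positivity
  have hlogK : 0 ≤ Real.log K := Real.log_natCast_nonneg K
  set ℓ₁ := max 0 (Real.log (tr L * R ^ ν / Real.sqrt δ)) with hℓ₁
  set ℓ₂ := max 0 (Real.log (tr Sig / Real.sqrt δ)) with hℓ₂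
  have h1 : 0 ≤ ℓ₁ := le_max_left _ _
  have h2 : 0 ≤ ℓ₂ := le_max_left _ _
  refine ⟨100 * (1 + Real.log K + ℓ₁ + ℓ₂), by positivity, le_rfl, hint, ?_⟩
  set κ : ℝ := (K : ℝ) + 2 with hκ
  set C := 100 * (1 + Real.log K + ℓ₁ + ℓ₂) with hC
  have hτ := tr_nonneg hf.posDef.nonneg
  have hσ := tr_nonneg hG.posDef.nonneg
  have e1 : κ ^ (3 * (1 - ν) / 2) = κ ^ 2 / κ ^ ((1 + 3 * ν) / 2) := by
    rw [← Real.rpow_natCast κ 2, ← Real.rpow_sub hκ0]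
    congr 1; push_cast; ring
  have e2 : κ ^ (3 / 2 : ℝ) = κ ^ 2 / Real.sqrt κ := by
    rw [Real.sqrt_eq_rpow, ← Real.rpow_natCast κ 2, ← Real.rpow_sub hκ0]
    norm_num
  have b1 : R ^ (1 + ν) * κ ^ (3 * (1 - ν) / 2) * tr L * (1 / 2 + 4 * (6 + 3 / 2 * Real.log K + ℓ₁))
      ≤ R ^ (1 + ν) * κ ^ (3 * (1 - ν) / 2) * tr L * (C / 4) := by
    refine mul_le_mul_of_nonneg_left ?_ (by positivity)
    linarith
  have b2 : R * κ ^ (3 / 2 : ℝ) * tr Sig * (1 / 2 + 4 * (6 + 3 / 2 * Real.log K + ℓ₂))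
      ≤ R * κ ^ (3 / 2 : ℝ) * tr Sig * (C / 4) := by
    refine mul_le_mul_of_nonneg_left ?_ (by positivity)
    linarith
  rw [e1] at b1
  rw [e2] at b2
  rw [e1, e2] at hle
  have hκ2 : 0 < κ ^ 2 / 4 := by positivity
  refine le_of_mul_le_mul_left (hle.trans ?_) hκ2
  have e3 : κ ^ 2 / 4 * (C * tr L * R ^ (1 + ν) / κ ^ ((1 + 3 * ν) / 2) + C * tr Sig * R / Real.sqrt κ
        + 4 * Real.sqrt δ * R * (Module.finrank ℝ X : ℝ) / κ ^ 2)
      = R * Real.sqrt δ * Module.finrank ℝ X + R * (κ ^ 2 / Real.sqrt κ) * tr Sig * (C / 4)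
        + R ^ (1 + ν) * (κ ^ 2 / κ ^ ((1 + 3 * ν) / 2)) * tr L * (C / 4) := by
    field_simp
    ring
  rw [e3]
  linarith
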